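/- Let $m\ge 2$, let $S^d$ be the unit sphere of $\mathbb{R}^{d+1}$ and let $\cdot$ denote the usual inner product. A real kernel $K$ on a nonempty set $X$ is positive definite if it is symmetric and $\sum_{\mu,\nu=1}^n c_\mu c_\nu K(x_\mu,x_\nu)\ge 0$ for all $n\ge 1$, all distinct $x_1,\dots,x_n\in X$ and all real $c_1,\dots,c_n$; it is strictly positive definite if, moreover, the inequality is strict whenever some $c_\mu\ne 0$. Let $P_l^m$ be the Gegenbauer polynomial of degree $l$ and parameter $(m-1)/2$, normalized by $P_l^m(1)=\binom{l+m-2}{l}$, and let $P_0^1=1$, $P_k^1(\cos\theta)=\frac{2}{k}\cos k\theta$ for $k\ge 1$. Let $f\colon[-1,1]^2\to\mathbb{R}$ be continuous and such that the kernel $((x,z),(y,w))\mapsto f(x\cdot y,z\cdot w)$ on $S^1\times S^m$ is positive definite. Then $f$ has a representation $$f(t,s)=\sum_{k,l=0}^\infty a_{k,l}P_k^1(t)P_l^m(s),\qquad t,s\in[-1,1],$$ with $a_{k,l}\ge 0$ for all $k,l$ and $\sum_{k,l}a_{k,l}P_k^1(1)P_l^m(1)<\infty$. For any such representation put $f_l(t)=\sum_{k=0}^\infty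 a_{k,l}P_k^1(t)$, so that $f(t,s)=\sum_{l=0}^\infty f_l(t)P_l^m(s)$, and for each integer $\gamma\ge 0$ put $$f_\gamma^{\rm o}=\sum_{2l+1\ge\gamma}f_{2l+1},\qquad f_\gamma^{\rm e}=\sum_{2l\ge\gamma}f_{2l}.$$ The following assertions are equivalent: (i) the kernel $((x,z),(y,w))\mapsto f(x\cdot y,z\cdot w)$ on $S^1\times S^m$ is strictly positive definite; (ii) for each integer $\gamma\ge 0$, the functions $f_\gamma^{\rm o}$ and $f_\gamma^{\rm e}$ are continuous on $[-1,1]$ and the kernels $(x,y)\mapsto f_\gamma^{\rm o}(x\cdot y)$ and $(x,y)\mapsto f_\gamma^{\rm e}(x\cdot y)$ on $S^1$ are strictly positive definite. -/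

import Mathlib

open Polynomial

noncomputable section

namespace SpherePD

/-- The unit sphere `S^m` of `ℝ^(m+1)`. -/
abbrev Sph (m : ℕ) : Type := Metric.sphere (0 : EuclideanSpace ℝ (Fin (m + 1))) 1

/-- The usual inner product `x ⋅ y` of `ℝ^(m+1)`, for two points of `S^m`. -/
def dotS {m : ℕ} (x y : Sph m) : ℝ :=
  inner ℝ (x : EuclideanSpace ℝ (Fin (m + 1))) (y : EuclideanSpace ℝ (Fin (m + 1)))

/-- Positive definiteness of a real kernel on a set `X`. -/
def IsPosDefKernel {X : Type*} (K : X → X → ℝ) : Prop :=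
  (∀ x y, K x y = K y x) ∧
    ∀ (n : ℕ) (x : Fin n → X), Function.Injective x → ∀ c : Fin n → ℝ,
      0 ≤ ∑ i, ∑ j, c i * c j * K (x i) (x j)

/-- Strict positive definiteness of a real kernel on a set `X`. -/
def IsStrictPosDefKernel {X : Type*} (K : X → X → ℝ) : Prop :=
  IsPosDefKernel K ∧
    ∀ (n : ℕ) (x : Fin n → X), Function.Injective x → ∀ c : Fin n → ℝ, c ≠ 0 →
      0 < ∑ i, ∑ j, c i * c j * K (x i) (x j)

/-- The Gegenbauer polynomials `C_n^lam`, by their three-term recurrence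
`n C_n = 2 (n + lam - 1) X C_(n-1) - (n + 2 lam - 2) C_(n-2)`. -/
def gegenbauer (lam : ℝ) : ℕ → ℝ[X]
  | 0 => 1
  | 1 => C (2 * lam) * X
  | (n + 2) => C (1 / ((n : ℝ) + 2)) *
      (C (2 * ((n : ℝ) + 1 + lam)) * X * gegenbauer lam (n + 1)
        - C ((n : ℝ) + 2 * lam) * gegenbauer lam n)

/-- The polynomials `P_n^m` attached to `S^m`. For `m ≥ 2` this is the Gegenbauer polynomial of
parameter `(m - 1) / 2`, so that `P_n^m(1) = binom (n + m - 2) n`. For `m = 1` the parameter is `0`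
and the usual convention is `P_0^1 = 1`, `P_n^1(cos θ) = (2 / n) cos (n θ)`. -/
def sphPoly (m n : ℕ) : ℝ[X] :=
  if m = 1 then
    if n = 0 then 1 else C (2 / (n : ℝ)) * Chebyshev.T ℝ (n : ℤ)
  else gegenbauer (((m : ℝ) - 1) / 2) n

/-- The kernel `((x,z),(y,w)) ↦ f(x ⋅ y, z ⋅ w)` on `S^1 × S^m`. -/
def prodKernel (m : ℕ) (f : ℝ → ℝ → ℝ) : Sph 1 × Sph m → Sph 1 × Sph m → ℝ :=
  fun p q => f (dotS p.1 q.1) (dotS p.2 q.2)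

/-- `f`, continuous on `[-1,1]²`, generates an isotropic positive definite kernel on
`S^1 × S^m`. -/
def GeneratesPosDef (m : ℕ) (f : ℝ → ℝ → ℝ) : Prop :=
  ContinuousOn (fun p : ℝ × ℝ => f p.1 p.2) (Set.Icc (-1) 1 ×ˢ Set.Icc (-1) 1) ∧
    IsPosDefKernel (prodKernel m f)

/-- `g`, continuous on `[-1,1]`, generates an isotropic strictly positive definite kernel on
`S^1`. -/
def GeneratesStrictPosDefCircle (g : ℝ → ℝ) : Prop :=
  ContinuousOn g (Set.Icc (-1) 1) ∧
    IsStrictPosDefKernel (fun x y : Sph 1 => g (dotS x y))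

/-- `a` is the family of coefficients of a double series representation
`f(t,s) = ∑_{k,l} a_{k,l} P_k^1(t) P_l^m(s)` on `[-1,1]²`, with `a_{k,l} ≥ 0` and
`∑_{k,l} a_{k,l} P_k^1(1) P_l^m(1) < ∞`. -/
structure IsExpansion (m : ℕ) (f : ℝ → ℝ → ℝ) (a : ℕ → ℕ → ℝ) : Prop where
  nonneg : ∀ k l, 0 ≤ a k l
  summable : Summable fun p : ℕ × ℕ =>
    a p.1 p.2 * (sphPoly 1 p.1).eval 1 * (sphPoly m p.2).eval 1
  hasSum : ∀ t ∈ Set.Icc (-1 : ℝ) 1, ∀ s ∈ Set.Icc (-1 : ℝ) 1,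
    HasSum (fun p : ℕ × ℕ => a p.1 p.2 * (sphPoly 1 p.1).eval t * (sphPoly m p.2).eval s) (f t s)

/-- The function `f_l(t) = ∑_k a_{k,l} P_k^1(t)`, for which `f(t,s) = ∑_l f_l(t) P_l^m(s)`. -/
def component (a : ℕ → ℕ → ℝ) (l : ℕ) (t : ℝ) : ℝ :=
  ∑' k, a k l * (sphPoly 1 k).eval t

/-- The truncated sum `∑_{2l+1 ≥ γ} f_{2l+1}`. -/
def oddTail (a : ℕ → ℕ → ℝ) (γ : ℕ) (t : ℝ) : ℝ :=
  ∑' l : {l : ℕ // γ ≤ 2 * l + 1}, component a (2 * l.1 + 1) t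

/-- The truncated sum `∑_{2l ≥ γ} f_{2l}`. -/
def evenTail (a : ℕ → ℕ → ℝ) (γ : ℕ) (t : ℝ) : ℝ :=
  ∑' l : {l : ℕ // γ ≤ 2 * l}, component a (2 * l.1) t

end SpherePD

end

/-! Each kernel P_l^m(x ⋅ y) is a finite sum of products φ(x) φ(y) (`IsZonal.exists_features`).
Hence the quadratic form of f at finitely many points is a series of nonnegative terms a_{k,l}
Q_{k,l}, and it vanishes exactly when Q_{k,l} = 0 for all (k,l) with a_{k,l} ≠ 0
(`IsExpansion.quadForm_eq_zero_iff`). The tails on the circle obey the same rule.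

(i) ⇒ (ii): place 2N equally spaced points on a great circle of S^m, with alternating signs as
weights. P_l^m(cos θ) has only frequencies of size at most l and of the parity of l, while
alternating signs detect only frequencies congruent to N mod 2N. So all degrees l < N and all
degrees of the wrong parity are annihilated (`exists_annihilating_weights`). Tensoring with weights
on S^1 for which a tail degenerates annihilates the other terms as well.

(ii) ⇒ (i): for |s| < 1 the ratio P_l^m(s) / P_l^m(1) tends to 0 (`tendsto_sphPoly_div`). On a
finite set closed under antipodes, only the pairs w = ±z therefore matter for large l, and Q_{k,l} =
0 forces the form of P_k^1 to vanish on the weights c(x,z) + (-1)^l c(x,-z). The odd and even tails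
then give c(x,z) - c(x,-z) = 0 and c(x,z) + c(x,-z) = 0, so c = 0.

Existence: the coefficients are moments of f against orthogonal products of zonal polynomials. They
are nonnegative because a continuous positive definite kernel has nonnegative mean. Testing f on
powers of (1 + t)/2, which concentrate at 1, bounds their sum, and the resulting uniformly
convergent series has the same moments as f (`exists_isExpansion`). -/

noncomputable section

namespace SpherePD

/-! ### Gegenbauer and Chebyshev polynomials as zonal polynomials -/

/-- The properties of `P_l^m` used below: it is a polynomial of degree `l` with the parity of `l`
and positive leading coefficient that solves the ultraspherical differential equation. -/
structure IsZonal (m l : ℕ) (P : ℝ[X]) : Prop where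
  support : ∀ j, P.coeff j ≠ 0 → ∃ i, j + 2 * i = l
  lead : 0 < P.coeff l
  ode : (1 - X ^ 2) * derivative (derivative P) - C (m : ℝ) * X * derivative P
    + C ((l : ℝ) * (l + m - 1)) * P = 0

lemma gegenbauer_add_two (lam : ℝ) (n : ℕ) :
    C ((n : ℝ) + 2) * gegenbauer lam (n + 2) =
      C (2 * ((n : ℝ) + 1 + lam)) * X * gegenbauer lam (n + 1)
        - C ((n : ℝ) + 2 * lam) * gegenbauer lam n := by
  have h : (n : ℝ) + 2 ≠ 0 := by positivity
  rw [gegenbauer, ← mul_assoc, ← C_mul, mul_one_div_cancel h, C_1, one_mul]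

/-- The two identities need a joint induction: the differentiated recurrence and the second identity
at `n` give the first at `n + 1`, from which the second at `n + 1` follows. -/
lemma derivative_gegenbauer_succ (lam : ℝ) (n : ℕ) :
    derivative (gegenbauer lam (n + 1)) = X * derivative (gegenbauer lam n)
        + C ((n : ℝ) + 2 * lam) * gegenbauer lam n ∧
      X * derivative (gegenbauer lam (n + 1)) - derivative (gegenbauer lam n) =
        C ((n : ℝ) + 1) * gegenbauer lam (n + 1) := by
  induction n with
  | zero => simp [gegenbauer, mul_comm]
  | succ n ih =>
    obtain ⟨hE, hF⟩ := ih
    have h0 : (C ((n : ℝ) + 2) : ℝ[X]) ≠ 0 := by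
      rw [Ne, C_eq_zero]; positivity
    have hr := gegenbauer_add_two lam n
    have hd := congrArg derivative hr
    simp only [derivative_mul, derivative_C, derivative_X, zero_mul, zero_add, mul_one,
      derivative_sub] at hd
    simp only [map_add, map_mul, C_1, map_ofNat] at *
    have e1 : derivative (gegenbauer lam (n + 2)) = X * derivative (gegenbauer lam (n + 1))
        + ((C (n : ℝ)) + 1 + 2 * C lam) * gegenbauer lam (n + 1) := by
      apply mul_left_cancel₀ h0
      linear_combination hd + (C (n : ℝ) + 2 * C lam) * hF
    constructor
    · push_cast
      simp only [map_add, C_1]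
      exact e1
    · push_cast
      simp only [map_add, C_1]
      linear_combination X * e1 - hr - hE + X * hF

lemma gegenbauer_support (lam : ℝ) (n : ℕ) :
    ∀ j, (gegenbauer lam n).coeff j ≠ 0 → ∃ i, j + 2 * i = n := by
  induction n using Nat.twoStepInduction with
  | zero =>
    intro j hj
    rw [gegenbauer, coeff_one] at hj
    exact ⟨0, by simpa using hj⟩
  | one =>
    intro j hj
    rw [gegenbauer, coeff_C_mul, coeff_X] at hj
    refine ⟨0, ?_⟩
    by_contra h
    exact hj (by rw [if_neg (by omega)]; simp)
  | more n h1 h2 =>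
    intro j hj
    rw [gegenbauer, coeff_C_mul, coeff_sub, coeff_C_mul, mul_assoc, coeff_C_mul] at hj
    by_cases ha : (X * gegenbauer lam (n + 1)).coeff j = 0
    · have hb : (gegenbauer lam n).coeff j ≠ 0 := by
        intro hb
        exact hj (by rw [ha, hb]; simp)
      obtain ⟨i, hi⟩ := h1 j hb
      exact ⟨i + 1, by omega⟩
    · cases j with
      | zero => simp at ha
      | succ j =>
        rw [coeff_X_mul] at ha
        obtain ⟨i, hi⟩ := h2 j ha
        exact ⟨i, by omega⟩

lemma gegenbauer_lead {lam : ℝ} (hl : 0 < lam) (n : ℕ) : 0 < (gegenbauer lam n).coeff n := by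
  induction n with
  | zero => simp [gegenbauer]
  | succ n ih =>
    cases n with
    | zero => simp [gegenbauer, hl]
    | succ n =>
      have h0 : (gegenbauer lam n).coeff (n + 2) = 0 := by
        by_contra h
        obtain ⟨i, hi⟩ := gegenbauer_support lam n _ h
        omega
      rw [gegenbauer, coeff_C_mul, coeff_sub, coeff_C_mul, mul_assoc, coeff_C_mul, coeff_X_mul, h0]
      have : 0 < 2 * ((n : ℝ) + 1 + lam) := by positivity
      have := mul_pos this ih
      rw [mul_zero, sub_zero]
      positivity

/-- Differentiating both first-order identities allows `gegenbauer lam (n + 1)` to be eliminated. -/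
lemma gegenbauer_ode (lam : ℝ) (n : ℕ) :
    (1 - X ^ 2) * derivative (derivative (gegenbauer lam n))
      - C (2 * lam + 1) * X * derivative (gegenbauer lam n)
      + C ((n : ℝ) * (n + 2 * lam)) * gegenbauer lam n = 0 := by
  obtain ⟨hE, hF⟩ := derivative_gegenbauer_succ lam n
  have hd := congrArg derivative hE
  have hd2 := congrArg derivative hF
  simp only [derivative_mul, derivative_C, derivative_X, zero_mul, zero_add, one_mul,
      derivative_sub, derivative_add] at hd hd2
  simp only [map_add, map_mul, C_1, map_ofNat] at *
  have hh : C (n : ℝ) * derivative (gegenbauer lam (n + 1))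
      + derivative (derivative (gegenbauer lam n)) = X * derivative (derivative (gegenbauer lam (n + 1))) := by
    linear_combination -hd2
  linear_combination hh + X * hd - (C (n : ℝ)) * hE

lemma isZonal_gegenbauer {m : ℕ} (hm : 2 ≤ m) (l : ℕ) :
    IsZonal m l (gegenbauer (((m : ℝ) - 1) / 2) l) := by
  have hm' : (2 : ℝ) ≤ m := by exact_mod_cast hm
  refine ⟨gegenbauer_support _ l, gegenbauer_lead (by linarith) l, ?_⟩
  have h := gegenbauer_ode (((m : ℝ) - 1) / 2) l
  rwa [show 2 * (((m : ℝ) - 1) / 2) + 1 = m by ring,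
    show (l : ℝ) + 2 * (((m : ℝ) - 1) / 2) = l + m - 1 by ring] at h

lemma chebyshev_support (n : ℕ) :
    ∀ j, (Chebyshev.T ℝ (n : ℤ)).coeff j ≠ 0 → ∃ i, j + 2 * i = n := by
  induction n using Nat.twoStepInduction with
  | zero =>
    intro j hj
    simp only [Nat.cast_zero, Chebyshev.T_zero, coeff_one] at hj
    exact ⟨0, by simpa using hj⟩
  | one =>
    intro j hj
    simp only [Nat.cast_one, Chebyshev.T_one, coeff_X] at hj
    exact ⟨0, by have := (ite_ne_right_iff.1 hj).1; omega⟩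
  | more n h1 h2 =>
    intro j hj
    rw [show ((n + 2 : ℕ) : ℤ) = (n : ℤ) + 2 by push_cast; ring, Chebyshev.T_add_two, coeff_sub,
      mul_assoc, ← C_ofNat, coeff_C_mul] at hj
    push_cast at h2
    by_cases ha : (X * Chebyshev.T ℝ ((n : ℤ) + 1)).coeff j = 0
    · have hb : (Chebyshev.T ℝ (n : ℤ)).coeff j ≠ 0 := by
        intro hb
        exact hj (by rw [ha, hb]; simp)
      obtain ⟨i, hi⟩ := h1 j hb
      exact ⟨i + 1, by omega⟩
    · cases j with
      | zero => simp at ha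
      | succ j =>
        rw [coeff_X_mul] at ha
        obtain ⟨i, hi⟩ := h2 j ha
        exact ⟨i, by omega⟩

lemma isZonal_chebyshev (l : ℕ) : IsZonal 1 l (Chebyshev.T ℝ (l : ℤ)) := by
  refine ⟨chebyshev_support l, ?_, ?_⟩
  · have h := Chebyshev.leadingCoeff_T ℝ (l : ℤ)
    rw [leadingCoeff, Chebyshev.natDegree_T, Int.natAbs_natCast] at h
    rw [h]; positivity
  · have h := Chebyshev.one_sub_X_sq_mul_derivative_derivative_T_eq_poly_in_T (R := ℝ) (l : ℤ)
    simp only [map_mul, map_add, map_sub, map_natCast, C_1] at *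
    push_cast at h ⊢
    simp only [Function.iterate_succ, Function.iterate_zero, Function.comp] at h
    simp only [id] at h
    linear_combination h

lemma IsZonal.C_mul {m l : ℕ} {P : ℝ[X]} (h : IsZonal m l P) {c : ℝ} (hc : 0 < c) :
    IsZonal m l (C c * P) := by
  refine ⟨fun j hj => h.support j ?_, ?_, ?_⟩
  · rw [coeff_C_mul] at hj
    exact right_ne_zero_of_mul hj
  · rw [coeff_C_mul]; exact mul_pos hc h.lead
  · have := h.ode
    simp only [derivative_mul, derivative_C, zero_mul, zero_add]
    linear_combination C c * this

lemma isZonal_sphPoly {m : ℕ} (hm : 1 ≤ m) (l : ℕ) : IsZonal m l (sphPoly m l) := by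
  unfold sphPoly
  split_ifs with h1 h2
  · subst h1 h2
    simpa using isZonal_chebyshev 0
  · subst h1
    exact (isZonal_chebyshev l).C_mul (by positivity)
  · exact isZonal_gegenbauer (by omega) l

lemma IsZonal.eval_neg {m l : ℕ} {P : ℝ[X]} (h : IsZonal m l P) (s : ℝ) :
    P.eval (-s) = (-1) ^ l * P.eval s := by
  rw [eval_eq_sum, eval_eq_sum, Polynomial.sum, Polynomial.sum, Finset.mul_sum]
  refine Finset.sum_congr rfl fun j hj => ?_
  obtain ⟨i, rfl⟩ := h.support j (mem_support_iff.1 hj)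
  rw [neg_pow, pow_add, pow_mul]
  norm_num
  ring

lemma IsZonal.natDegree_eq {m l : ℕ} {P : ℝ[X]} (h : IsZonal m l P) : P.natDegree = l := by
  refine natDegree_eq_of_le_of_coeff_ne_zero ?_ h.lead.ne'
  refine natDegree_le_iff_coeff_eq_zero.2 fun j hj => ?_
  by_contra h'
  obtain ⟨i, hi⟩ := h.support j h'
  omega

/-- At the point 1 both derivative identities express the same difference of derivatives; equating
them gives the ratio of consecutive values. -/
lemma gegenbauer_eval_one_succ (lam : ℝ) (n : ℕ) :
    ((n : ℝ) + 1) * (gegenbauer lam (n + 1)).eval 1 =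
      (n + 2 * lam) * (gegenbauer lam n).eval 1 := by
  obtain ⟨hE, hF⟩ := derivative_gegenbauer_succ lam n
  have h1 := congrArg (eval 1) hE
  have h2 := congrArg (eval 1) hF
  simp only [eval_add, eval_mul, eval_X, eval_C, eval_sub] at h1 h2
  linarith

/-- The ratio (n + 2 lam)/(n + 1) is at least 1. For m ≥ 2 this permits dropping the factor P_l^m(1)
from the summability of an expansion, which makes the tails converge. -/
lemma one_le_gegenbauer_eval_one {lam : ℝ} (hl : 1 / 2 ≤ lam) (n : ℕ) :
    1 ≤ (gegenbauer lam n).eval 1 := by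
  induction n with
  | zero => simp [gegenbauer]
  | succ n ih =>
    have h := gegenbauer_eval_one_succ lam n
    have h0 : 0 < (n : ℝ) + 1 := by positivity
    by_contra! hc
    nlinarith

lemma one_le_sphPoly_eval_one {m : ℕ} (hm : 2 ≤ m) (l : ℕ) : 1 ≤ (sphPoly m l).eval 1 := by
  have hm' : (2 : ℝ) ≤ m := by exact_mod_cast hm
  rw [sphPoly, if_neg (by omega)]
  exact one_le_gegenbauer_eval_one (by linarith) l

/-! ### Decay of normalized Gegenbauer polynomials inside (-1, 1) -/

open Filter Topology in
/-- Solutions of the damped recurrence satisfied by the normalized Gegenbauer polynomials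
at a point `s ∈ (-1, 1)` tend to zero. -/
lemma tendsto_zero_of_damped_recurrence {lam s : ℝ} (hl : 0 < lam) (hs : s ^ 2 < 1) {R : ℕ → ℝ}
    (hR : ∀ n : ℕ, ((n : ℝ) + 1 + 2 * lam) * R (n + 2) =
      2 * ((n : ℝ) + 1 + lam) * s * R (n + 1) - ((n : ℝ) + 1) * R n) :
    Tendsto R atTop (𝓝 0) := by
  set δ : ℕ → ℝ := fun n => lam / ((n : ℝ) + 1 + 2 * lam) with hδ
  set w : ℕ → ℝ := fun n => s * R (n + 1) - R n with hw
  -- This energy equals R_n² - 2 s R_n R_{n+1} + R_{n+1}², which the undamped Chebyshev recurrence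
  -- conserves; the damping `δ` makes it decrease.
  set E : ℕ → ℝ := fun n => w n ^ 2 + (1 - s ^ 2) * R (n + 1) ^ 2 with hE
  have hδ0 : ∀ n, 0 < δ n := fun n => by simp only [hδ]; positivity
  have hδ1 : ∀ n, δ n ≤ 1 / 2 := fun n => by
    simp only [hδ]
    rw [div_le_iff₀ (by positivity)]
    have : (0 : ℝ) ≤ n := n.cast_nonneg
    linarith
  have hδm : ∀ n, δ (n + 1) ≤ δ n := fun n => by
    simp only [hδ]
    apply div_le_div_of_nonneg_left hl.le (by positivity)
    push_cast; linarith
  have hR2 : ∀ n, R (n + 2) = s * R (n + 1) + (1 - 2 * δ n) * w n := fun n => by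
    have h0 : (n : ℝ) + 1 + 2 * lam ≠ 0 := by positivity
    apply mul_left_cancel₀ h0
    rw [hR n]
    simp only [hδ, hw]
    field_simp
    ring
  have hEs : ∀ n, E (n + 1) = E n - 4 * δ n * (1 - δ n) * w n ^ 2 := fun n => by
    simp only [hE]
    have : w (n + 1) = s * R (n + 2) - R (n + 1) := rfl
    rw [this, show n + 1 + 1 = n + 2 from rfl, hR2 n]
    ring
  -- The loss at one step involves only `w n`, which may be small by itself; two consecutive values
  -- of `w` always control the energy.
  have hwsum : ∀ n, (1 - s ^ 2) * E n ≤ 3 * (w n ^ 2 + w (n + 1) ^ 2) := fun n => by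
    have h1 : (1 - s ^ 2) * R (n + 1) = s * (1 - 2 * δ n) * w n - w (n + 1) := by
      have : w (n + 1) = s * R (n + 2) - R (n + 1) := rfl
      rw [this, hR2 n]; ring
    have h2 : (1 - s ^ 2) * E n =
        (1 - s ^ 2) * w n ^ 2 + (s * (1 - 2 * δ n) * w n - w (n + 1)) ^ 2 := by
      rw [← h1]; simp only [hE]; ring
    have h3 : (s * (1 - 2 * δ n)) ^ 2 ≤ 1 := by
      rw [mul_pow]
      have : (1 - 2 * δ n) ^ 2 ≤ 1 := by nlinarith [hδ0 n, hδ1 n]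
      nlinarith [sq_nonneg s, sq_nonneg (1 - 2 * δ n)]
    have h4 := mul_le_mul_of_nonneg_right h3 (sq_nonneg (w n))
    rw [h2]
    nlinarith [sq_nonneg (s * (1 - 2 * δ n) * w n + w (n + 1)), sq_nonneg (w n),
      mul_nonneg (sq_nonneg s) (sq_nonneg (w n))]
  have hE0 : ∀ n, 0 ≤ E n := fun n => by
    simp only [hE]
    have : 0 ≤ 1 - s ^ 2 := by linarith
    positivity
  have hanti : Antitone E := antitone_nat_of_succ_le fun n => by
    rw [hEs n]
    have : 0 ≤ 1 - δ n := by linarith [hδ1 n]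
    have := hδ0 n
    have : 0 ≤ 4 * δ n * (1 - δ n) * w n ^ 2 := by positivity
    linarith
  have hlim := tendsto_atTop_ciInf hanti ⟨0, by rintro _ ⟨n, rfl⟩; exact hE0 n⟩
  set L := ⨅ n, E n with hL
  have hLE : ∀ n, L ≤ E n := fun n => hanti.le_of_tendsto hlim n
  have hL0 : 0 ≤ L := ge_of_tendsto' hlim hE0
  have hdrop : ∀ n, 2 / 3 * (1 - s ^ 2) * L * δ (n + 1) ≤ E n - E (n + 2) := fun n => by
    have e1 := hEs n
    have e2 := hEs (n + 1)
    have a1 : 2 * δ (n + 1) ≤ 4 * δ n * (1 - δ n) := by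
      nlinarith [hδm n, hδ0 n, hδ1 n]
    have a2 : 2 * δ (n + 1) ≤ 4 * δ (n + 1) * (1 - δ (n + 1)) := by
      nlinarith [hδ0 (n + 1), hδ1 (n + 1)]
    have b1 := mul_le_mul_of_nonneg_right a1 (sq_nonneg (w n))
    have b2 := mul_le_mul_of_nonneg_right a2 (sq_nonneg (w (n + 1)))
    have c1 : (1 - s ^ 2) * L ≤ 3 * (w n ^ 2 + w (n + 1) ^ 2) :=
      (mul_le_mul_of_nonneg_left (hLE n) (by linarith)).trans (hwsum n)
    have c2 := mul_le_mul_of_nonneg_right c1 (hδ0 (n + 1)).le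
    rw [show n + 2 = n + 1 + 1 from rfl, e2, e1]
    linarith
  have hLz : L = 0 := by
    by_contra hne
    have hLp : 0 < L := lt_of_le_of_ne hL0 (Ne.symm hne)
    -- If the limit energy were positive, each double step would lose at least a fixed multiple of
    -- 1/(n + 1), so the harmonic series would converge.
    set κ := 2 / 3 * (1 - s ^ 2) * L * (lam / (2 + 2 * lam)) with hκ
    have hκ0 : 0 < κ := by
      have : 0 < 1 - s ^ 2 := by linarith
      positivity
    have hlow : ∀ n : ℕ, κ * (1 / ((n : ℝ) + 1)) ≤ E n - E (n + 2) := fun n => by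
      refine le_trans ?_ (hdrop n)
      rw [hκ, mul_assoc]
      apply mul_le_mul_of_nonneg_left
      · simp only [hδ]
        rw [div_mul_div_comm, mul_one]
        apply div_le_div_of_nonneg_left hl.le (by positivity)
        push_cast
        have : (0 : ℝ) ≤ n := n.cast_nonneg
        nlinarith
      · have : 0 < 1 - s ^ 2 := by linarith
        positivity
    have hsum : Summable fun n : ℕ => κ * (1 / ((n : ℝ) + 1)) := by
      refine summable_of_sum_range_le (c := E 0 + E 1) (fun n => by positivity) fun N => ?_
      have h1 : ∀ N, ∑ n ∈ Finset.range N, (E n - E (n + 2)) = E 0 + E 1 - E N - E (N + 1) := by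
        intro N
        induction N with
        | zero => simp
        | succ N ih => rw [Finset.sum_range_succ, ih]; ring
      calc _ ≤ ∑ n ∈ Finset.range N, (E n - E (n + 2)) := Finset.sum_le_sum fun n _ => hlow n
        _ ≤ _ := by rw [h1]; linarith [hE0 N, hE0 (N + 1)]
    have h2 := (summable_mul_left_iff hκ0.ne').1 hsum
    have h3 : Summable fun n : ℕ => 1 / ((n : ℝ)) := by
      rw [← summable_nat_add_iff 1]
      simpa using h2
    exact Real.not_summable_one_div_natCast h3
  rw [hLz] at hlim
  have hsq : Tendsto (fun n => R (n + 1) ^ 2) atTop (𝓝 0) := by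
    have hp : 0 < 1 - s ^ 2 := by linarith
    refine squeeze_zero (fun n => sq_nonneg _) (fun n => ?_)
      (by simpa using hlim.div_const (1 - s ^ 2))
    rw [le_div_iff₀ hp]
    simp only [hE]
    nlinarith [sq_nonneg (w n)]
  rw [← tendsto_add_atTop_iff_nat 1]
  have := hsq.sqrt
  simp only [Real.sqrt_sq_eq_abs, Real.sqrt_zero] at this
  exact (tendsto_zero_iff_abs_tendsto_zero _).2 this

open Filter Topology in
lemma tendsto_gegenbauer_div {lam s : ℝ} (hl : 1 / 2 ≤ lam) (hs : s ^ 2 < 1) :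
    Tendsto (fun n => (gegenbauer lam n).eval s / (gegenbauer lam n).eval 1) atTop (𝓝 0) := by
  refine tendsto_zero_of_damped_recurrence (lam := lam) (s := s) (by linarith) hs fun n => ?_
  have p0 := one_le_gegenbauer_eval_one hl n
  have p1 := one_le_gegenbauer_eval_one hl (n + 1)
  have p2 := one_le_gegenbauer_eval_one hl (n + 2)
  have r0 := gegenbauer_eval_one_succ lam n
  have r1 := gegenbauer_eval_one_succ lam (n + 1)
  have hr := congrArg (eval s) (gegenbauer_add_two lam n)
  simp only [eval_mul, eval_C, eval_sub, eval_X] at hr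
  push_cast at r1
  rw [show n + 1 + 1 = n + 2 from rfl] at r1
  set a := (gegenbauer lam n).eval 1
  set b := (gegenbauer lam (n + 1)).eval 1
  set c := (gegenbauer lam (n + 2)).eval 1
  set x := (gegenbauer lam n).eval s
  set y := (gegenbauer lam (n + 1)).eval s
  set z := (gegenbauer lam (n + 2)).eval s
  have hn : (0 : ℝ) ≤ n := n.cast_nonneg
  have ha : a ≠ 0 := by linarith
  have hb : b ≠ 0 := by linarith
  have hc : c ≠ 0 := by linarith
  -- Dividing by the values at 1 shifts the coefficients: with the ratios `e1` and `e2` the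
  -- three-term recurrence takes the damped form.
  have e1 : ((n : ℝ) + 1 + 2 * lam) / c = (n + 2) / b := by
    rw [div_eq_div_iff hc hb]; linarith
  have e2 : ((n : ℝ) + 1) / a = (n + 2 * lam) / b := by
    rw [div_eq_div_iff ha hb]; linarith
  calc ((n : ℝ) + 1 + 2 * lam) * (z / c) = ((n : ℝ) + 1 + 2 * lam) / c * z := by ring
    _ = ((n + 2) * z) / b := by rw [e1]; ring
    _ = 2 * (n + 1 + lam) * s * (y / b) - (n + 2 * lam) / b * x := by rw [hr]; ring
    _ = _ := by rw [← e2]; ring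

open Filter Topology in
lemma tendsto_sphPoly_div {m : ℕ} (hm : 2 ≤ m) {s : ℝ} (hs : s ^ 2 < 1) :
    Tendsto (fun l => (sphPoly m l).eval s / (sphPoly m l).eval 1) atTop (𝓝 0) := by
  have hm' : (2 : ℝ) ≤ m := by exact_mod_cast hm
  simp only [sphPoly, if_neg (show m ≠ 1 by omega)]
  exact tendsto_gegenbauer_div (by linarith) hs

/-! ### A weak addition theorem through the Fischer inner product -/

section Fischer

open MvPolynomial
open scoped Nat

variable {ι : Type*} [Fintype ι]

/-- The Fischer inner product on polynomials, for which multiplication by a variable is adjoint to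
differentiation in that variable. -/
def fischer : MvPolynomial ι ℝ →ₗ[ℝ] MvPolynomial ι ℝ →ₗ[ℝ] ℝ :=
  (MvPolynomial.basisMonomials ι ℝ).constr ℝ fun α =>
    ((∏ i, (α i)! : ℕ) : ℝ) • MvPolynomial.lcoeff ℝ α

lemma fischer_monomial (α : ι →₀ ℕ) (a : ℝ) (q : MvPolynomial ι ℝ) :
    fischer (MvPolynomial.monomial α a) q =
      a * ((∏ i, (α i)! : ℕ) : ℝ) * MvPolynomial.coeff α q := by
  have h : MvPolynomial.monomial α a = a • MvPolynomial.basisMonomials ι ℝ α := by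
    rw [MvPolynomial.coe_basisMonomials, MvPolynomial.smul_monomial, smul_eq_mul, mul_one]
  rw [h, map_smul, fischer, Module.Basis.constr_basis]
  simp [mul_assoc]

lemma fischer_X_mul (i : ι) (p q : MvPolynomial ι ℝ) :
    fischer (MvPolynomial.X i * p) q = fischer p (pderiv i q) := by
  classical
  induction p using MvPolynomial.induction_on' with
  | add p₁ p₂ h₁ h₂ =>
    rw [mul_add, map_add, map_add, LinearMap.add_apply, LinearMap.add_apply, h₁, h₂]
  | monomial α a =>
    rw [MvPolynomial.X, MvPolynomial.monomial_mul, one_mul, add_comm, fischer_monomial,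
      fischer_monomial, coeff_pderiv]
    have : (∏ k, ((α + Finsupp.single i 1 : ι →₀ ℕ) k)!) = (α i + 1) * ∏ k, (α k)! := by
      rw [← Finset.mul_prod_erase _ _ (Finset.mem_univ i),
        ← Finset.mul_prod_erase _ (fun k => (α k)!) (Finset.mem_univ i), ← mul_assoc]
      congr 1
      · simp [Nat.factorial_succ]
      · refine Finset.prod_congr rfl fun k hk => ?_
        rw [Finsupp.add_apply, Finsupp.single_eq_of_ne (Finset.ne_of_mem_erase hk), add_zero]
    rw [this]
    push_cast
    ring

/-- The linear form with coefficients `x`. -/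
def linForm (x : ι → ℝ) : MvPolynomial ι ℝ := ∑ i, MvPolynomial.C (x i) * MvPolynomial.X i

/-- The sum of the squares of the variables. -/
def sqNorm (ι : Type*) [Fintype ι] : MvPolynomial ι ℝ := ∑ i, MvPolynomial.X i * MvPolynomial.X i

lemma linForm_isHomogeneous (x : ι → ℝ) : (linForm x).IsHomogeneous 1 :=
  IsHomogeneous.sum _ _ _ fun i _ => by
    simpa using (isHomogeneous_C ι (x i)).mul (isHomogeneous_X ℝ i)

lemma sqNorm_isHomogeneous : (sqNorm ι).IsHomogeneous 2 :=
  IsHomogeneous.sum _ _ _ fun i _ => (isHomogeneous_X ℝ i).mul (isHomogeneous_X ℝ i)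

lemma pderiv_linForm (x : ι → ℝ) (i : ι) : pderiv i (linForm x) = MvPolynomial.C (x i) := by
  classical
  simp [linForm, pderiv_X, Pi.single_apply]

lemma pderiv_sqNorm (i : ι) : pderiv i (sqNorm ι) = 2 * MvPolynomial.X i := by
  classical
  simp [sqNorm, pderiv_X, Pi.single_apply, Finset.sum_add_distrib, two_mul]

/-- Powers of linear forms reproduce point values: each factor becomes a derivative in direction
`x`, and Euler's identity for homogeneous polynomials evaluates it. -/
lemma fischer_linForm_pow (x : ι → ℝ) (l : ℕ) {q : MvPolynomial ι ℝ} (hq : q.IsHomogeneous l) :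
    fischer (linForm x ^ l) q = (l ! : ℝ) * MvPolynomial.eval x q := by
  induction l generalizing q with
  | zero =>
    have h1 : (1 : MvPolynomial ι ℝ) = MvPolynomial.monomial 0 1 := rfl
    rw [← totalDegree_zero_iff_isHomogeneous, totalDegree_eq_zero_iff_eq_C] at hq
    rw [pow_zero, h1, fischer_monomial, hq]
    simp
  | succ l ih =>
    have h1 : linForm x ^ (l + 1) = ∑ i, x i • (MvPolynomial.X i * linForm x ^ l) := by
      rw [pow_succ', linForm, Finset.sum_mul]
      refine Finset.sum_congr rfl fun i _ => ?_
      rw [MvPolynomial.smul_eq_C_mul, mul_assoc]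
    have he := congrArg (MvPolynomial.eval x) hq.sum_X_mul_pderiv
    rw [map_sum] at he
    simp only [map_mul, MvPolynomial.eval_X, nsmul_eq_mul, map_natCast] at he
    rw [h1, map_sum, LinearMap.sum_apply]
    simp only [map_smul, LinearMap.smul_apply, fischer_X_mul, smul_eq_mul]
    rw [Finset.sum_congr rfl fun i _ => by rw [ih (by simpa using hq.pderiv)]]
    rw [Nat.factorial_succ]
    push_cast at he ⊢
    rw [mul_comm ((l : ℝ) + 1), mul_assoc, ← he, Finset.mul_sum]
    exact Finset.sum_congr rfl fun i _ => by ring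

/-- The truncated exponents are harmless, since the prefactors vanish when `j < 2`, respectively `k
= 0`. -/
lemma laplacian_linForm_pow_mul_sqNorm_pow {y : ι → ℝ} (hy : ∑ i, y i * y i = 1) (j k : ℕ) :
    ∑ i, pderiv i (pderiv i (linForm y ^ j * sqNorm ι ^ k)) =
      (j : MvPolynomial ι ℝ) * (j - 1) * linForm y ^ (j - 2) * sqNorm ι ^ k
      + (2 * k * (2 * j + 2 * k + Fintype.card ι - 2) : MvPolynomial ι ℝ)
        * linForm y ^ j * sqNorm ι ^ (k - 1) := by
  set L := linForm y with hL
  set N := sqNorm ι with hN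
  have cast (a : ℕ) : (a : MvPolynomial ι ℝ) * ((a - 1 : ℕ) : MvPolynomial ι ℝ) = a * (a - 1) := by
    cases a <;> simp
  have hpow (a : ℕ) (Q : MvPolynomial ι ℝ) :
      (a : MvPolynomial ι ℝ) * (Q ^ (a - 1) * Q) = a * Q ^ a := by
    cases a <;> simp [pow_succ]
  have hpow2 (a : ℕ) (Q : MvPolynomial ι ℝ) :
      (a : MvPolynomial ι ℝ) * (a - 1) * (Q ^ (a - 1 - 1) * Q) = a * (a - 1) * Q ^ (a - 1) := by
    rw [← cast, mul_assoc, mul_assoc, hpow]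
  have hterm (i : ι) : pderiv i (pderiv i (L ^ j * N ^ k)) =
      ((j : MvPolynomial ι ℝ) * ((j : MvPolynomial ι ℝ) - 1) * L ^ (j - 2) * N ^ k)
          * MvPolynomial.C (y i * y i)
      + (4 * (j : MvPolynomial ι ℝ) * (k : MvPolynomial ι ℝ) * L ^ (j - 1) * N ^ (k - 1))
          * (MvPolynomial.C (y i) * MvPolynomial.X i)
      + (4 * (k : MvPolynomial ι ℝ) * ((k : MvPolynomial ι ℝ) - 1) * L ^ j * N ^ (k - 1 - 1))
          * (MvPolynomial.X i * MvPolynomial.X i)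
      + 2 * (k : MvPolynomial ι ℝ) * L ^ j * N ^ (k - 1) := by
    simp only [pderiv_mul, pderiv_pow, hL, hN, pderiv_linForm, pderiv_sqNorm, map_add, pderiv_C,
      pderiv_X_self, Derivation.map_natCast]
    have h2 : pderiv i (2 : MvPolynomial ι ℝ) = 0 := by
      simpa using Derivation.map_natCast (pderiv (R := ℝ) i) 2
    rw [h2, show j - 2 = j - 1 - 1 from rfl, MvPolynomial.C_mul]
    linear_combination (linForm y ^ (j - 1 - 1) * sqNorm ι ^ k * MvPolynomial.C (y i)
        * MvPolynomial.C (y i)) * cast j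
      + (4 * linForm y ^ j * sqNorm ι ^ (k - 1 - 1) * MvPolynomial.X i * MvPolynomial.X i) * cast k
  rw [Finset.sum_congr rfl fun i _ => hterm i]
  simp only [Finset.sum_add_distrib, ← Finset.mul_sum]
  rw [← map_sum, hy, MvPolynomial.C_1, Finset.sum_const, Finset.card_univ, nsmul_eq_mul]
  change _ + _ * L + _ * N + _ = _
  linear_combination (4 * k * N ^ (k - 1)) * hpow j L + 4 * L ^ j * hpow2 k N

variable {m l : ℕ} {P : ℝ[X]}

/-- The homogeneous extension of `x ↦ P (x ⋅ y)` from the unit sphere. -/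
def homExt (l : ℕ) (P : ℝ[X]) (y : ι → ℝ) : MvPolynomial ι ℝ :=
  ∑ j ∈ Finset.range (l + 1), P.coeff j • (linForm y ^ j * sqNorm ι ^ ((l - j) / 2))

/-- By parity the division in `(l - j) / 2` is exact wherever the coefficient is nonzero. -/
lemma IsZonal.isHomogeneous_homExt (h : IsZonal m l P) (y : ι → ℝ) :
    (homExt l P y).IsHomogeneous l := by
  refine IsHomogeneous.sum _ _ _ fun j _ => ?_
  by_cases hc : P.coeff j = 0
  · rw [hc, zero_smul]; exact isHomogeneous_zero _ _ _
  · obtain ⟨i, hi⟩ := h.support j hc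
    rw [MvPolynomial.smul_eq_C_mul]
    have := (isHomogeneous_C ι (P.coeff j)).mul (((linForm_isHomogeneous y).pow j).mul
      ((sqNorm_isHomogeneous (ι := ι)).pow ((l - j) / 2)))
    convert this using 1
    omega

lemma IsZonal.eval_homExt (h : IsZonal m l P) {x y : ι → ℝ} (hx : ∑ i, x i * x i = 1) :
    MvPolynomial.eval x (homExt l P y) = P.eval (∑ i, x i * y i) := by
  have h1 : MvPolynomial.eval x (linForm y) = ∑ i, x i * y i := by
    simp [linForm, mul_comm]
  have h2 : MvPolynomial.eval x (sqNorm ι) = 1 := by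
    simpa [sqNorm] using hx
  rw [Polynomial.eval_eq_sum_range' (n := l + 1) (by rw [h.natDegree_eq]; omega), homExt, map_sum]
  exact Finset.sum_congr rfl fun j _ => by
    rw [MvPolynomial.smul_eval, map_mul, map_pow, map_pow, h1, h2]; simp

lemma IsZonal.coeff_recurrence (h : IsZonal m l P) (j : ℕ) :
    ((l : ℝ) - j) * (l + j + m - 1) * P.coeff j = -((j + 2) * (j + 1) * P.coeff (j + 2)) := by
  have h0 := congrArg (fun p => p.coeff j) h.ode
  have e : (1 - Polynomial.X ^ 2) * derivative (derivative P)
      = derivative (derivative P) - Polynomial.X * (Polynomial.X * derivative (derivative P)) := by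
    ring
  simp only [e, Polynomial.coeff_add, Polynomial.coeff_sub, mul_assoc, Polynomial.coeff_C_mul,
    Polynomial.coeff_zero] at h0
  rcases j with _ | _ | j
  · simp [Polynomial.coeff_derivative] at h0 ⊢
    linarith
  · simp [Polynomial.coeff_derivative, Polynomial.coeff_X_mul] at h0 ⊢
    linarith
  · simp [Polynomial.coeff_derivative, Polynomial.coeff_X_mul] at h0 ⊢
    linarith

/-- The ultraspherical equation is what makes the extension harmonic: by the coefficient recurrence
the Laplacian of the term of index `j` is a difference `A j - A (j + 2)`, and the sum telescopes. -/
lemma IsZonal.laplacian_homExt (h : IsZonal m l P) (hc : Fintype.card ι = m + 1)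
    {y : ι → ℝ} (hy : ∑ i, y i * y i = 1) :
    ∑ i, pderiv i (pderiv i (homExt l P y)) = 0 := by
  set A : ℕ → MvPolynomial ι ℝ := fun j =>
    ((j : ℝ) * (j - 1) * P.coeff j) • (linForm y ^ (j - 2) * sqNorm ι ^ ((l - j) / 2)) with hA
  have hterm : ∀ j ∈ Finset.range (l + 1), ∑ i, pderiv i (pderiv i
      (P.coeff j • (linForm y ^ j * sqNorm ι ^ ((l - j) / 2)))) = A j - A (j + 2) := by
    intro j hj
    simp only [Derivation.map_smul, ← Finset.smul_sum]
    rw [laplacian_linForm_pow_mul_sqNorm_pow hy]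
    by_cases hz : P.coeff j = 0
    · have hz2 : ((j : ℝ) + 2) * (j + 1) * P.coeff (j + 2) = 0 := by
        have := h.coeff_recurrence j
        rw [hz] at this; linarith
      have hz3 : P.coeff (j + 2) = 0 := by
        have : ((j : ℝ) + 2) * (j + 1) ≠ 0 := by positivity
        exact (mul_eq_zero.1 hz2).resolve_left this
      simp [hA, hz, hz3]
    · obtain ⟨k, hk⟩ := h.support j hz
      have hk1 : (l - j) / 2 = k := by omega
      have hk2 : (l - (j + 2)) / 2 = k - 1 := by omega
      have hr := h.coeff_recurrence j
      have hl : (l : ℝ) = j + 2 * k := by rw [← hk]; push_cast; ring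
      simp only [hA, hk1, hk2, hc]
      have e1 : ((j + 2 : ℕ) : ℝ) * (((j + 2 : ℕ) : ℝ) - 1) * P.coeff (j + 2) =
          -(2 * k * (2 * j + 2 * k + (m + 1 : ℕ) - 2) * P.coeff j) := by
        rw [hl] at hr
        push_cast
        linear_combination hr
      rw [e1]
      simp only [MvPolynomial.smul_eq_C_mul, map_neg, map_mul, map_add, map_sub, map_natCast,
        MvPolynomial.C_1, map_ofNat]
      rw [show j + 2 - 2 = j by omega]
      ring
  -- Of the four boundary terms, `A 0` and `A 1` vanish through the factor j(j - 1), the other two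
  -- because they lie beyond the degree.
  have htel : ∀ n, ∑ j ∈ Finset.range n, (A j - A (j + 2)) = A 0 + A 1 - A n - A (n + 1) := by
    intro n
    induction n with
    | zero => simp
    | succ n ih => rw [Finset.sum_range_succ, ih]; ring
  have hz : ∀ j, l < j → A j = 0 := fun j hj => by
    have : P.coeff j = 0 := by
      by_contra hne
      obtain ⟨i, hi⟩ := h.support j hne
      omega
    simp [hA, this]
  unfold homExt
  simp only [map_sum]
  rw [Finset.sum_comm, Finset.sum_congr rfl hterm, htel, hz (l + 1) (by omega),
    hz (l + 1 + 1) (by omega)]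
  simp [hA]

/-- Modulo multiples of `sqNorm`, the left polynomial is its top power of a linear form.
Multiplication by `sqNorm` is adjoint to the Laplacian, which annihilates the right polynomial, so
only the reproducing term remains. -/
lemma IsZonal.fischer_homExt (h : IsZonal m l P) (hc : Fintype.card ι = m + 1)
    {x y : ι → ℝ} (hx : ∑ i, x i * x i = 1) (hy : ∑ i, y i * y i = 1) :
    fischer (homExt l P x) (homExt l P y) = P.coeff l * l ! * P.eval (∑ i, x i * y i) := by
  set r : MvPolynomial ι ℝ :=
    ∑ j ∈ Finset.range l, P.coeff j • (linForm x ^ j * sqNorm ι ^ ((l - j) / 2 - 1)) with hr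
  have hdec : homExt l P x =
      P.coeff l • linForm x ^ l + ∑ i, MvPolynomial.X i * (MvPolynomial.X i * r) := by
    have e : ∑ i, MvPolynomial.X i * (MvPolynomial.X i * r) = sqNorm ι * r := by
      rw [sqNorm, Finset.sum_mul]
      exact Finset.sum_congr rfl fun i _ => by ring
    rw [e, hr, homExt, Finset.sum_range_succ, Nat.sub_self, Finset.mul_sum, add_comm]
    simp only [Nat.zero_div, pow_zero, mul_one]
    congr 1
    refine Finset.sum_congr rfl fun j hj => ?_
    by_cases hz : P.coeff j = 0
    · simp [hz]
    · obtain ⟨k, hk⟩ := h.support j hz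
      have hj' := Finset.mem_range.1 hj
      obtain ⟨k', hk'⟩ : ∃ k', (l - j) / 2 = k' + 1 := ⟨k - 1, by omega⟩
      rw [hk', Nat.add_sub_cancel, mul_smul_comm]
      congr 1
      ring
  rw [hdec, map_add, LinearMap.add_apply, map_smul, LinearMap.smul_apply,
    fischer_linForm_pow x l (h.isHomogeneous_homExt y), h.eval_homExt hx, map_sum,
    LinearMap.sum_apply]
  simp only [fischer_X_mul]
  rw [← map_sum, h.laplacian_homExt hc hy, map_zero]
  simp [mul_assoc]

lemma fischer_eq_sum {p q : MvPolynomial ι ℝ} [DecidableEq ι] (hp : p.IsHomogeneous l) :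
    fischer p q = ∑ α ∈ Finset.finsuppAntidiag (Finset.univ : Finset ι) l,
      ((∏ i, (α i)! : ℕ) : ℝ) * MvPolynomial.coeff α p * MvPolynomial.coeff α q := by
  conv_lhs => rw [p.as_sum]
  rw [map_sum, LinearMap.sum_apply]
  simp only [fischer_monomial]
  rw [Finset.sum_subset (s₂ := Finset.finsuppAntidiag (Finset.univ : Finset ι) l)]
  · exact Finset.sum_congr rfl fun α _ => by ring
  · intro α hα
    rw [Finset.mem_finsuppAntidiag]
    refine ⟨?_, Finset.subset_univ _⟩
    by_contra hne
    refine MvPolynomial.mem_support_iff.1 hα (hp.coeff_eq_zero ?_)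
    rwa [Finsupp.degree_eq_sum]
  · intro α _ hα
    rw [MvPolynomial.notMem_support_iff.1 hα]; ring

end Fischer

lemma dotS_eq_sum {m : ℕ} (x y : Sph m) : dotS x y = ∑ i, x.1 i * y.1 i := by
  simp [dotS, PiLp.inner_apply, mul_comm]

lemma dotS_self {m : ℕ} (x : Sph m) : dotS x x = 1 := by
  rw [dotS, real_inner_self_eq_norm_sq]
  have : ‖(x : EuclideanSpace ℝ (Fin (m + 1)))‖ = 1 := by simp
  rw [this]; norm_num

/-- A weak form of the addition theorem: `P_l^m(x ⋅ y)` is a finite sum of products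
`φ(x) φ(y)`. -/
lemma IsZonal.exists_features {m l : ℕ} {P : ℝ[X]} (h : IsZonal m l P) :
    ∃ (A : Finset (Fin (m + 1) →₀ ℕ)) (φ : (Fin (m + 1) →₀ ℕ) → Sph m → ℝ),
      ∀ x y : Sph m, P.eval (dotS x y) = ∑ α ∈ A, φ α x * φ α y := by
  classical
  -- The Fischer product is diagonal in the monomials with positive weights α!, so the features are
  -- the rescaled coefficients of the harmonic extension.
  refine ⟨Finset.finsuppAntidiag Finset.univ l, fun α x =>
    Real.sqrt (((∏ i, (α i).factorial : ℕ) : ℝ) / (P.coeff l * l.factorial)) *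
      (homExt l P x.1).coeff α, fun x y => ?_⟩
  have hl := h.lead
  have hx : ∑ i, x.1 i * x.1 i = 1 := by rw [← dotS_eq_sum, dotS_self]
  have hy : ∑ i, y.1 i * y.1 i = 1 := by rw [← dotS_eq_sum, dotS_self]
  have hf := h.fischer_homExt (ι := Fin (m + 1)) (by simp) hx hy
  have hpos : 0 < P.coeff l * (l.factorial : ℝ) := by positivity
  rw [fischer_eq_sum (h.isHomogeneous_homExt _), ← dotS_eq_sum] at hf
  apply mul_left_cancel₀ hpos.ne'
  rw [← hf, Finset.mul_sum]
  refine Finset.sum_congr rfl fun α _ => ?_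
  set F : ℝ := ((∏ i, (α i).factorial : ℕ) : ℝ) with hF
  have hs := Real.mul_self_sqrt (show 0 ≤ F / (P.coeff l * l.factorial) by positivity)
  set S := Real.sqrt (F / (P.coeff l * l.factorial))
  have hs' : P.coeff l * l.factorial * (S * S) = F := by
    rw [hs]; field_simp
  linear_combination (-(homExt l P x.1).coeff α * (homExt l P y.1).coeff α) * hs'

/-! ### Quadratic forms of kernels and geometry of the sphere -/

section Kernels

variable {X : Type*} {K : X → X → ℝ}

/-- The quadratic form of a kernel on a finite set of points. -/
def quadForm (K : X → X → ℝ) (S : Finset X) (c : X → ℝ) : ℝ :=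
  ∑ p ∈ S, ∑ q ∈ S, c p * c q * K p q

lemma sum_fin_eq_quadForm (K : X → X → ℝ) {n : ℕ} {x : Fin n → X} (hx : Function.Injective x)
    (c : Fin n → ℝ) : ∑ i, ∑ j, c i * c j * K (x i) (x j) =
      quadForm K (Finset.univ.map ⟨x, hx⟩) (Function.extend x c 0) := by
  simp [quadForm, hx.extend_apply]

lemma quadForm_eq_sum_fin (K : X → X → ℝ) (S : Finset X) (c : X → ℝ) :
    quadForm K S c = ∑ i, ∑ j, c (S.equivFin.symm i) * c (S.equivFin.symm j) *
      K (S.equivFin.symm i) (S.equivFin.symm j) := by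
  rw [quadForm, ← Finset.sum_coe_sort, ← S.equivFin.symm.sum_comp]
  refine Finset.sum_congr rfl fun i _ => ?_
  rw [← Finset.sum_coe_sort, ← S.equivFin.symm.sum_comp]

lemma IsPosDefKernel.quadForm_nonneg (h : IsPosDefKernel K) (S : Finset X) (c : X → ℝ) :
    0 ≤ quadForm K S c := by
  rw [quadForm_eq_sum_fin]
  exact h.2 _ (fun i => (S.equivFin.symm i : X))
    (Subtype.val_injective.comp S.equivFin.symm.injective) fun i => c (S.equivFin.symm i)

lemma isPosDefKernel_of_quadForm (hs : ∀ x y, K x y = K y x)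
    (h : ∀ S c, 0 ≤ quadForm K S c) : IsPosDefKernel K :=
  ⟨hs, fun _ _ hx c => by rw [sum_fin_eq_quadForm K hx]; exact h _ _⟩

lemma IsStrictPosDefKernel.eq_zero (h : IsStrictPosDefKernel K) {S : Finset X} {c : X → ℝ}
    (h0 : quadForm K S c = 0) : ∀ p ∈ S, c p = 0 := by
  intro p hp
  by_contra hc
  have := h.2 _ (fun i => (S.equivFin.symm i : X))
    (Subtype.val_injective.comp S.equivFin.symm.injective) (fun i => c (S.equivFin.symm i)) (by
      intro he
      have := congrFun he (S.equivFin ⟨p, hp⟩)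
      simp at this
      exact hc this)
  rw [← quadForm_eq_sum_fin K S c, h0] at this
  exact lt_irrefl _ this

lemma IsPosDefKernel.isStrictPosDefKernel (h : IsPosDefKernel K)
    (h0 : ∀ S c, quadForm K S c = 0 → ∀ p ∈ S, c p = 0) : IsStrictPosDefKernel K := by
  refine ⟨h, fun n x hx c hc => ?_⟩
  rw [sum_fin_eq_quadForm K hx]
  refine lt_of_le_of_ne (h.quadForm_nonneg _ _) fun he => hc ?_
  funext i
  have := h0 _ _ he.symm (x i) (by simp)
  rwa [hx.extend_apply] at this

/-- Padding the weights with zeros lets an arbitrary finite set be replaced by a product set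
containing it. -/
lemma quadForm_congr_of_subset {S T : Finset X} (hST : S ⊆ T) {c d : X → ℝ}
    (hcd : ∀ p ∈ S, d p = c p) (hd : ∀ p ∈ T, p ∉ S → d p = 0) :
    quadForm K T d = quadForm K S c := by
  unfold quadForm
  rw [← Finset.sum_subset hST fun p hp hps => by simp [hd p hp hps]]
  refine Finset.sum_congr rfl fun p hp => ?_
  rw [← Finset.sum_subset hST fun q hq hqs => by simp [hd q hq hqs]]
  exact Finset.sum_congr rfl fun q hq => by rw [hcd p hp, hcd q hq]

end Kernels

section Sphere

variable {m : ℕ}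

lemma dotS_comm (x y : Sph m) : dotS x y = dotS y x := real_inner_comm _ _

lemma norm_sph (x : Sph m) : ‖(x : EuclideanSpace ℝ (Fin (m + 1)))‖ = 1 := by simp

lemma dotS_eq_one_iff {x y : Sph m} : dotS x y = 1 ↔ x = y := by
  rw [dotS, inner_eq_one_iff_of_norm_eq_one (norm_sph x) (norm_sph y), Subtype.ext_iff]

lemma dotS_neg_right (x y : Sph m) : dotS x (-y) = -dotS x y := by
  simp [dotS]

lemma dotS_neg_left (x y : Sph m) : dotS (-x) y = -dotS x y := by
  simp [dotS]

lemma abs_dotS_le_one (x y : Sph m) : |dotS x y| ≤ 1 := by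
  simpa [dotS] using abs_real_inner_le_norm (x : EuclideanSpace ℝ (Fin (m + 1))) y

lemma dotS_mem_Icc (x y : Sph m) : dotS x y ∈ Set.Icc (-1 : ℝ) 1 := abs_le.1 (abs_dotS_le_one x y)

lemma dotS_sq_lt_one {x y : Sph m} (h1 : y ≠ x) (h2 : y ≠ -x) : dotS x y ^ 2 < 1 := by
  rw [sq_lt_one_iff_abs_lt_one]
  refine lt_of_le_of_ne (abs_dotS_le_one x y) fun h => ?_
  rcases (abs_eq zero_le_one).1 h with h | h
  · exact h1 (dotS_eq_one_iff.1 h).symm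
  · have : dotS y (-x) = 1 := by rw [dotS_neg_right, dotS_comm, h, neg_neg]
    exact h2 (dotS_eq_one_iff.1 this)

lemma exists_great_circle (hm : 1 ≤ m) :
    ∃ u : ℝ → Sph m, ∀ θ θ', dotS (u θ) (u θ') = Real.cos (θ - θ') := by
  obtain ⟨k, rfl⟩ : ∃ k, m = k + 1 := ⟨m - 1, by omega⟩
  have hi (θ θ' : ℝ) : inner ℝ
      (EuclideanSpace.single (0 : Fin (k + 1 + 1)) (Real.cos θ)
        + EuclideanSpace.single 1 (Real.sin θ))
      (EuclideanSpace.single (0 : Fin (k + 1 + 1)) (Real.cos θ')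
        + EuclideanSpace.single 1 (Real.sin θ')) = Real.cos (θ - θ') := by
    simp [inner_add_left, inner_add_right, EuclideanSpace.inner_single_left, Real.cos_sub]
  refine ⟨fun θ =>
    ⟨EuclideanSpace.single 0 (Real.cos θ) + EuclideanSpace.single 1 (Real.sin θ), ?_⟩,
    fun θ θ' => hi θ θ'⟩
  rw [mem_sphere_zero_iff_norm, ← sq_eq_sq₀ (norm_nonneg _) zero_le_one,
    ← real_inner_self_eq_norm_sq, hi]
  simp

lemma exists_dotS_eq (hm : 1 ≤ m) {s : ℝ} (hs : s ∈ Set.Icc (-1 : ℝ) 1) :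
    ∃ x y : Sph m, dotS x y = s := by
  obtain ⟨u, hu⟩ := exists_great_circle hm
  exact ⟨u (Real.arccos s), u 0, by rw [hu, sub_zero, Real.cos_arccos hs.1 hs.2]⟩

variable {l : ℕ} {P : ℝ[X]}

/-- Expand Σ (φ(x) ± φ(y))² ≥ 0 over the features; both diagonal sums equal `P.eval 1`. -/
lemma IsZonal.abs_eval_le (h : IsZonal m l P) (hm : 1 ≤ m) {s : ℝ} (hs : s ∈ Set.Icc (-1 : ℝ) 1) :
    |P.eval s| ≤ P.eval 1 := by
  obtain ⟨x, y, rfl⟩ := exists_dotS_eq hm hs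
  obtain ⟨A, φ, hφ⟩ := h.exists_features
  have hx := hφ x x
  have hy := hφ y y
  rw [dotS_self] at hx hy
  rw [hφ x y, abs_le]
  have h1 : 0 ≤ ∑ α ∈ A, (φ α x + φ α y) ^ 2 := Finset.sum_nonneg fun _ _ => sq_nonneg _
  have h2 : 0 ≤ ∑ α ∈ A, (φ α x - φ α y) ^ 2 := Finset.sum_nonneg fun _ _ => sq_nonneg _
  have e1 : ∑ α ∈ A, (φ α x + φ α y) ^ 2 =
      ∑ α ∈ A, φ α x * φ α x + ∑ α ∈ A, φ α y * φ α y + 2 * ∑ α ∈ A, φ α x * φ α y := by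
    rw [Finset.mul_sum, ← Finset.sum_add_distrib, ← Finset.sum_add_distrib]
    exact Finset.sum_congr rfl fun _ _ => by ring
  have e2 : ∑ α ∈ A, (φ α x - φ α y) ^ 2 =
      ∑ α ∈ A, φ α x * φ α x + ∑ α ∈ A, φ α y * φ α y - 2 * ∑ α ∈ A, φ α x * φ α y := by
    rw [Finset.mul_sum, ← Finset.sum_add_distrib, ← Finset.sum_sub_distrib]
    exact Finset.sum_congr rfl fun _ _ => by ring
  constructor <;> linarith

/-- The Schur product mechanism: multiplying a kernel by φ(p) φ(q) only changes the weights from `c`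
to `c φ`. -/
lemma quadForm_mul_features {X α : Type*} (A : Finset α) (φ : α → X → ℝ) (S : Finset X)
    (c : X → ℝ) (K : X → X → ℝ) :
    quadForm (fun p q => K p q * ∑ a ∈ A, φ a p * φ a q) S c =
      ∑ a ∈ A, quadForm K S fun p => c p * φ a p := by
  simp only [quadForm, Finset.mul_sum]
  rw [Finset.sum_comm (s := A)]
  refine Finset.sum_congr rfl fun x _ => ?_
  rw [Finset.sum_comm (s := A)]
  exact Finset.sum_congr rfl fun y _ => Finset.sum_congr rfl fun α _ => by ring

lemma quadForm_features {X α : Type*} (A : Finset α) (φ : α → X → ℝ) (S : Finset X)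
    (c : X → ℝ) : quadForm (fun p q => ∑ a ∈ A, φ a p * φ a q) S c =
      ∑ a ∈ A, (∑ p ∈ S, c p * φ a p) ^ 2 := by
  have h := quadForm_mul_features A φ S c fun _ _ => 1
  simp only [one_mul] at h
  rw [h]
  refine Finset.sum_congr rfl fun a _ => ?_
  simp only [quadForm, sq, Finset.sum_mul_sum, mul_one]

lemma IsZonal.quadForm_nonneg (h : IsZonal m l P) (S : Finset (Sph m)) (c : Sph m → ℝ) :
    0 ≤ quadForm (fun x y => P.eval (dotS x y)) S c := by
  obtain ⟨A, φ, hφ⟩ := h.exists_features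
  simp only [hφ]
  rw [quadForm_features]
  exact Finset.sum_nonneg fun _ _ => sq_nonneg _

end Sphere

/-! ### Quadratic forms of the double series and of its tails -/

lemma sphPoly_eval_one_pos {m : ℕ} (hm : 1 ≤ m) (l : ℕ) : 0 < (sphPoly m l).eval 1 := by
  rcases Nat.lt_or_ge m 2 with h | h
  · obtain rfl : m = 1 := by omega
    unfold sphPoly
    split_ifs with h2
    · simp
    · simp; omega
    · contradiction
  · exact zero_lt_one.trans_le (one_le_sphPoly_eval_one h l)

lemma hasSum_quadForm {ι X : Type*} {b : ι → ℝ} {g : ι → X → X → ℝ} {K : X → X → ℝ}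
    (h : ∀ p q, HasSum (fun i => b i * g i p q) (K p q)) (S : Finset X) (c : X → ℝ) :
    HasSum (fun i => b i * quadForm (g i) S c) (quadForm K S c) := by
  have := hasSum_sum (s := S) fun p _ => hasSum_sum (s := S) fun q _ =>
    (h p q).mul_left (c p * c q)
  have e : (fun i => b i * quadForm (g i) S c) =
      fun i => ∑ p ∈ S, ∑ q ∈ S, c p * c q * (b i * g i p q) := by
    funext i
    simp only [quadForm, Finset.mul_sum]
    exact Finset.sum_congr rfl fun p _ => Finset.sum_congr rfl fun q _ => by ring
  rw [e]
  exact this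

/-- The kernel `P_k^1(x ⋅ y) P_l^m(z ⋅ w)` on `S^1 × S^m`. -/
def zonalProd (m k l : ℕ) (p q : Sph 1 × Sph m) : ℝ :=
  (sphPoly 1 k).eval (dotS p.1 q.1) * (sphPoly m l).eval (dotS p.2 q.2)

section Expansion

variable {m : ℕ} {f : ℝ → ℝ → ℝ} {a : ℕ → ℕ → ℝ}

lemma zonalProd_quadForm_nonneg (hm : 1 ≤ m) (k l : ℕ) (S : Finset (Sph 1 × Sph m))
    (c : Sph 1 × Sph m → ℝ) : 0 ≤ quadForm (zonalProd m k l) S c := by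
  obtain ⟨A, φ, hφ⟩ := (isZonal_sphPoly le_rfl k).exists_features
  obtain ⟨B, ψ, hψ⟩ := (isZonal_sphPoly hm l).exists_features
  have h1 : zonalProd m k l = fun p q => (fun p q : Sph 1 × Sph m => ∑ b ∈ B, ψ b p.2 * ψ b q.2) p q
      * ∑ a ∈ A, φ a p.1 * φ a q.1 := by
    funext p q
    rw [zonalProd, hφ, hψ, mul_comm]
  rw [h1, quadForm_mul_features A (fun a (p : Sph 1 × Sph m) => φ a p.1)]
  refine Finset.sum_nonneg fun a _ => ?_
  rw [quadForm_features B (fun b (p : Sph 1 × Sph m) => ψ b p.2)]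
  exact Finset.sum_nonneg fun _ _ => sq_nonneg _

lemma IsExpansion.hasSum_quadForm (h : IsExpansion m f a) (S : Finset (Sph 1 × Sph m))
    (c : Sph 1 × Sph m → ℝ) :
    HasSum (fun i : ℕ × ℕ => a i.1 i.2 * quadForm (zonalProd m i.1 i.2) S c)
      (quadForm (prodKernel m f) S c) := by
  refine SpherePD.hasSum_quadForm (fun p q => ?_) S c
  simpa [zonalProd, prodKernel, mul_assoc] using
    h.hasSum _ (dotS_mem_Icc p.1 q.1) _ (dotS_mem_Icc p.2 q.2)

/-- A convergent series of nonnegative terms vanishes only termwise. Degeneracy thus depends only on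
which coefficients are nonzero, not on their size. -/
lemma IsExpansion.quadForm_eq_zero_iff (h : IsExpansion m f a) (hm : 1 ≤ m)
    (S : Finset (Sph 1 × Sph m)) (c : Sph 1 × Sph m → ℝ) :
    quadForm (prodKernel m f) S c = 0 ↔
      ∀ k l, a k l ≠ 0 → quadForm (zonalProd m k l) S c = 0 := by
  have hs := h.hasSum_quadForm S c
  have hn : ∀ i : ℕ × ℕ, 0 ≤ a i.1 i.2 * quadForm (zonalProd m i.1 i.2) S c := fun i =>
    mul_nonneg (h.nonneg _ _) (zonalProd_quadForm_nonneg hm _ _ _ _)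
  constructor
  · intro h0 k l hkl
    rw [h0, hasSum_zero_iff_of_nonneg hn] at hs
    exact (mul_eq_zero.1 (congrFun hs (k, l))).resolve_left hkl
  · intro h0
    refine hs.unique ?_
    convert hasSum_zero using 2 with i
    by_cases hi : a i.1 i.2 = 0
    · rw [hi, zero_mul]
    · rw [h0 _ _ hi, mul_zero]

/-- The sum of the components `f_l` over a family of indices `l`. -/
def tail {Λ : Type*} (a : ℕ → ℕ → ℝ) (e : Λ → ℕ) (t : ℝ) : ℝ := ∑' l, component a (e l) t

variable {Λ : Type*} {e : Λ → ℕ}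

lemma IsExpansion.summable_tail (h : IsExpansion m f a) (hm : 2 ≤ m) (he : Function.Injective e) :
    Summable fun i : Λ × ℕ => a i.2 (e i.1) * (sphPoly 1 i.2).eval 1 := by
  have h1 : Summable fun p : ℕ × ℕ => a p.1 p.2 * (sphPoly 1 p.1).eval 1 := by
    refine h.summable.of_nonneg_of_le (fun p => ?_) fun p => ?_
    · exact mul_nonneg (h.nonneg _ _) (sphPoly_eval_one_pos le_rfl _).le
    · exact le_mul_of_one_le_right
        (mul_nonneg (h.nonneg _ _) (sphPoly_eval_one_pos le_rfl _).le)
        (one_le_sphPoly_eval_one hm _)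
  exact h1.comp_injective (i := fun i : Λ × ℕ => (i.2, e i.1)) fun i j hij => by
    simp only [Prod.mk.injEq] at hij
    exact Prod.ext (he hij.2) hij.1

lemma IsExpansion.norm_tail_term_le (h : IsExpansion m f a) (i : Λ × ℕ) {t : ℝ}
    (ht : t ∈ Set.Icc (-1 : ℝ) 1) :
    ‖a i.2 (e i.1) * (sphPoly 1 i.2).eval t‖ ≤ a i.2 (e i.1) * (sphPoly 1 i.2).eval 1 := by
  rw [norm_mul, Real.norm_of_nonneg (h.nonneg _ _), Real.norm_eq_abs]
  exact mul_le_mul_of_nonneg_left ((isZonal_sphPoly le_rfl _).abs_eval_le le_rfl ht) (h.nonneg _ _)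

lemma IsExpansion.hasSum_tail (h : IsExpansion m f a) (hm : 2 ≤ m) (he : Function.Injective e)
    {t : ℝ} (ht : t ∈ Set.Icc (-1 : ℝ) 1) :
    HasSum (fun i : Λ × ℕ => a i.2 (e i.1) * (sphPoly 1 i.2).eval t) (tail a e t) := by
  have hs : Summable fun i : Λ × ℕ => a i.2 (e i.1) * (sphPoly 1 i.2).eval t :=
    (h.summable_tail hm he).of_norm_bounded fun i => h.norm_tail_term_le i ht
  have := hs.hasSum
  rwa [hs.tsum_prod] at this

lemma IsExpansion.continuousOn_tail (h : IsExpansion m f a) (hm : 2 ≤ m)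
    (he : Function.Injective e) : ContinuousOn (tail a e) (Set.Icc (-1) 1) := by
  have hc : ContinuousOn (fun t => ∑' i : Λ × ℕ, a i.2 (e i.1) * (sphPoly 1 i.2).eval t)
      (Set.Icc (-1) 1) :=
    continuousOn_tsum (fun i => (continuous_const.mul (sphPoly 1 i.2).continuous).continuousOn)
      (h.summable_tail hm he) fun i t ht => h.norm_tail_term_le i ht
  exact hc.congr fun t ht => (h.hasSum_tail hm he ht).tsum_eq.symm

/-- The kernel `P_k^1(x ⋅ y)` on `S^1`. -/
def zonalCircle (k : ℕ) (x y : Sph 1) : ℝ := (sphPoly 1 k).eval (dotS x y)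

lemma zonalCircle_quadForm_nonneg (k : ℕ) (S : Finset (Sph 1)) (c : Sph 1 → ℝ) :
    0 ≤ quadForm (zonalCircle k) S c :=
  (isZonal_sphPoly le_rfl k).quadForm_nonneg S c

lemma IsExpansion.hasSum_quadForm_tail (h : IsExpansion m f a) (hm : 2 ≤ m)
    (he : Function.Injective e) (S : Finset (Sph 1)) (c : Sph 1 → ℝ) :
    HasSum (fun i : Λ × ℕ => a i.2 (e i.1) * quadForm (zonalCircle i.2) S c)
      (quadForm (fun x y => tail a e (dotS x y)) S c) :=
  SpherePD.hasSum_quadForm (fun p q => h.hasSum_tail hm he (dotS_mem_Icc p q)) S c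

lemma IsExpansion.quadForm_tail_eq_zero_iff (h : IsExpansion m f a) (hm : 2 ≤ m)
    (he : Function.Injective e) (S : Finset (Sph 1)) (c : Sph 1 → ℝ) :
    quadForm (fun x y => tail a e (dotS x y)) S c = 0 ↔
      ∀ k l, a k (e l) ≠ 0 → quadForm (zonalCircle k) S c = 0 := by
  have hs := h.hasSum_quadForm_tail hm he S c
  have hn : ∀ i : Λ × ℕ, 0 ≤ a i.2 (e i.1) * quadForm (zonalCircle i.2) S c := fun i =>
    mul_nonneg (h.nonneg _ _) (zonalCircle_quadForm_nonneg _ _ _)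
  constructor
  · intro h0 k l hkl
    rw [h0, hasSum_zero_iff_of_nonneg hn] at hs
    exact (mul_eq_zero.1 (congrFun hs (l, k))).resolve_left hkl
  · intro h0
    refine hs.unique ?_
    convert hasSum_zero using 2 with i
    by_cases hi : a i.2 (e i.1) = 0
    · rw [hi, zero_mul]
    · rw [h0 _ _ hi, mul_zero]

lemma IsExpansion.isPosDefKernel_tail (h : IsExpansion m f a) (hm : 2 ≤ m)
    (he : Function.Injective e) : IsPosDefKernel fun x y : Sph 1 => tail a e (dotS x y) :=
  isPosDefKernel_of_quadForm (fun x y => by rw [dotS_comm]) fun S c =>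
    (h.hasSum_quadForm_tail hm he S c).nonneg fun i =>
      mul_nonneg (h.nonneg _ _) (zonalCircle_quadForm_nonneg _ _ _)

end Expansion

/-! ### Alternating weights on a great circle: (i) implies (ii) -/

section TrigonometricSums

open Complex
open scoped Real

/-- A geometric sum whose ratio is a 2N-th root of unity. The ratio is 1 only for k congruent to N
mod 2N, which either alternative excludes. -/
lemma sum_neg_one_pow_mul_exp_eq_zero {N : ℕ} (hN : 0 < N) {k : ℤ}
    (hk : |k| < N ∨ ¬ (2 : ℤ) ∣ k - N) :
    ∑ j ∈ Finset.range (2 * N), (-1 : ℂ) ^ j * exp (k * (π * j / N) * I) = 0 := by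
  have hN' : (N : ℂ) ≠ 0 := by exact_mod_cast hN.ne'
  set r : ℂ := -exp (k * (π / N) * I) with hr
  have hterm (j : ℕ) : (-1 : ℂ) ^ j * exp (k * (π * j / N) * I) = r ^ j := by
    rw [hr, neg_pow (exp _), ← exp_nat_mul]
    congr 2
    ring
  have hpow : r ^ (2 * N) = 1 := by
    rw [hr, neg_pow, ← exp_nat_mul, pow_mul, neg_one_sq, one_pow, one_mul, exp_eq_one_iff]
    refine ⟨k, ?_⟩
    push_cast
    field_simp
  have hne : r ≠ 1 := by
    intro h1
    have h2 : exp (k * (π / N) * I - π * I) = 1 := by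
      rw [exp_sub, exp_pi_mul_I, div_neg, div_one]
      exact h1
    obtain ⟨n, hn⟩ := exp_eq_one_iff.1 h2
    have hpi : (π : ℂ) ≠ 0 := by exact_mod_cast Real.pi_ne_zero
    have h3 : (k : ℂ) = N + 2 * N * n := by
      field_simp at hn
      linear_combination hn
    have h5 : k = N + 2 * N * n := by exact_mod_cast h3
    rcases hk with hk | hk
    · rw [abs_lt] at hk
      have : (0 : ℤ) < N := by exact_mod_cast hN
      rcases le_or_gt 0 n with hn0 | hn0
      · nlinarith
      · nlinarith
    · exact hk ⟨N * n, by rw [h5]; ring⟩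
  rw [Finset.sum_congr rfl fun j _ => hterm j, geom_sum_eq hne, hpow, sub_self, zero_div]

/-- Writing one cosine as a mean of exponentials replaces `n + 1` by `n` and `k` by `k ± 1`. The
extra frequency `k` is there for this induction; neither alternative of the hypothesis is lost. -/
lemma sum_neg_one_pow_mul_cos_pow_mul_exp_eq_zero {N : ℕ} (hN : 0 < N) (α : ℝ) (n : ℕ) {k : ℤ}
    (hk : |k| + n < N ∨ ¬ (2 : ℤ) ∣ k + n - N) :
    ∑ j ∈ Finset.range (2 * N), (-1 : ℂ) ^ j * cos (π * j / N - α) ^ n *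
      exp (k * (π * j / N) * I) = 0 := by
  induction n generalizing k with
  | zero =>
    simp only [pow_zero, mul_one]
    exact sum_neg_one_pow_mul_exp_eq_zero hN (by simpa using hk)
  | succ n ih =>
    have h1 := ih (k := k + 1) (by
      push_cast at hk
      rcases hk with hk | hk
      · left; have := abs_add_le k 1; simp at this; omega
      · right; intro h; exact hk (by convert h using 1; ring))
    have h2 := ih (k := k - 1) (by
      push_cast at hk
      rcases hk with hk | hk
      · left; have := abs_sub k 1; simp at this; omega
      · right; omega)
    have hterm (j : ℕ) : (-1 : ℂ) ^ j * cos (π * j / N - α) ^ (n + 1) * exp (k * (π * j / N) * I) =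
        exp (-α * I) / 2 * ((-1 : ℂ) ^ j * cos (π * j / N - α) ^ n *
          exp (((k + 1 : ℤ) : ℂ) * (π * j / N) * I)) +
        exp (α * I) / 2 * ((-1 : ℂ) ^ j * cos (π * j / N - α) ^ n *
          exp (((k - 1 : ℤ) : ℂ) * (π * j / N) * I)) := by
      have e1 : exp (-α * I) * exp (((k + 1 : ℤ) : ℂ) * (π * j / N) * I) =
          exp ((π * j / N - α) * I) * exp (k * (π * j / N) * I) := by
        rw [← exp_add, ← exp_add]; congr 1; push_cast; ring
      have e2 : exp (α * I) * exp (((k - 1 : ℤ) : ℂ) * (π * j / N) * I) =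
          exp (-(π * j / N - α) * I) * exp (k * (π * j / N) * I) := by
        rw [← exp_add, ← exp_add]; congr 1; push_cast; ring
      have e3 : cos (π * j / N - α) =
          (exp ((π * j / N - α) * I) + exp (-(π * j / N - α) * I)) / 2 := rfl
      rw [pow_succ]
      linear_combination ((-1 : ℂ) ^ j * cos (π * j / N - α) ^ n * exp (k * (π * j / N) * I)) * e3
        - ((-1 : ℂ) ^ j * cos (π * j / N - α) ^ n / 2) * (e1 + e2)
    rw [Finset.sum_congr rfl fun j _ => hterm j, Finset.sum_add_distrib, ← Finset.mul_sum,
      ← Finset.mul_sum, h1, h2]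
    simp

end TrigonometricSums

lemma IsZonal.sum_neg_one_pow_eval_cos {m l : ℕ} {P : ℝ[X]} (h : IsZonal m l P) {N : ℕ}
    (hN : 0 < N) (hl : l < N ∨ l % 2 ≠ N % 2) (α : ℝ) :
    ∑ j ∈ Finset.range (2 * N), (-1 : ℝ) ^ j * P.eval (Real.cos (Real.pi * j / N - α)) = 0 := by
  simp only [eval_eq_sum, Polynomial.sum, Finset.mul_sum]
  rw [Finset.sum_comm]
  refine Finset.sum_eq_zero fun n hn => ?_
  obtain ⟨i, hi⟩ := h.support n (mem_support_iff.1 hn)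
  have hc := sum_neg_one_pow_mul_cos_pow_mul_exp_eq_zero hN α n (k := 0) (by
    rcases hl with hl | hl
    · left; simp; omega
    · right; omega)
  have hr : ∑ j ∈ Finset.range (2 * N), (-1 : ℝ) ^ j * Real.cos (Real.pi * j / N - α) ^ n = 0 := by
    have h0 : ((∑ j ∈ Finset.range (2 * N),
        (-1 : ℝ) ^ j * Real.cos (Real.pi * j / N - α) ^ n : ℝ) : ℂ) = 0 := by
      push_cast
      simpa using hc
    exact_mod_cast h0
  calc _ = P.coeff n * ∑ j ∈ Finset.range (2 * N),
        (-1 : ℝ) ^ j * Real.cos (Real.pi * j / N - α) ^ n := by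
        rw [Finset.mul_sum]; exact Finset.sum_congr rfl fun j _ => by ring
    _ = 0 := by rw [hr, mul_zero]

/-- There is a nonzero discrete measure on `S^m` that annihilates the zonal polynomials of degree
less than `N` and those whose degree does not have the parity of `N`. -/
lemma exists_annihilating_weights {m : ℕ} (hm : 1 ≤ m) {N : ℕ} (hN : 0 < N) :
    ∃ (Z : Finset (Sph m)) (d : Sph m → ℝ), (∃ z ∈ Z, d z ≠ 0) ∧
      ∀ l, (l < N ∨ l % 2 ≠ N % 2) →
        quadForm (fun z w => (sphPoly m l).eval (dotS z w)) Z d = 0 := by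
  obtain ⟨u, hu⟩ := exists_great_circle hm
  have hN' : (N : ℝ) ≠ 0 := by exact_mod_cast hN.ne'
  set x : Fin (2 * N) → Sph m := fun j => u (Real.pi * (j : ℕ) / N) with hx
  have hinj : Function.Injective x := by
    intro i j hij
    have h1 : dotS (x i) (x j) = 1 := dotS_eq_one_iff.2 hij
    rw [hx, hu, Real.cos_eq_one_iff] at h1
    obtain ⟨n, hn⟩ := h1
    have h2 : (i : ℝ) - j = 2 * N * n := by
      field_simp at hn
      linear_combination -hn
    have h4 : ((i : ℕ) : ℤ) - (j : ℕ) = 2 * N * n := by exact_mod_cast h2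
    have hi := i.2
    have hj := j.2
    have hn0 : n = 0 := by
      by_contra hne
      rcases lt_or_gt_of_ne hne with h | h
      · have : (2 : ℤ) * N * n ≤ -(2 * N) := by nlinarith
        omega
      · have : (2 : ℤ) * N ≤ 2 * N * n := by nlinarith
        omega
    rw [hn0] at h4
    exact Fin.ext (by omega)
  refine ⟨Finset.univ.map ⟨x, hinj⟩, Function.extend x (fun j => (-1 : ℝ) ^ (j : ℕ)) 0, ?_, ?_⟩
  · refine ⟨x ⟨0, by omega⟩, by simp, ?_⟩
    rw [hinj.extend_apply]; simp
  · intro l hl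
    rw [← sum_fin_eq_quadForm _ hinj]
    -- The inner sum already vanishes at every node, because the angle `α` in the trigonometric
    -- identity is free.
    refine Finset.sum_eq_zero fun i _ => ?_
    have h := (isZonal_sphPoly hm l).sum_neg_one_pow_eval_cos hN hl (Real.pi * (i : ℕ) / N)
    rw [Finset.sum_range] at h
    calc _ = (-1 : ℝ) ^ (i : ℕ) * ∑ j : Fin (2 * N), (-1 : ℝ) ^ (j : ℕ) *
          (sphPoly m l).eval (Real.cos (Real.pi * (j : ℕ) / N - Real.pi * (i : ℕ) / N)) := by
          rw [Finset.mul_sum]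
          refine Finset.sum_congr rfl fun j _ => ?_
          rw [dotS_comm, hx, hu]
          ring
      _ = 0 := by rw [h, mul_zero]

lemma quadForm_zonalProd_product {m : ℕ} (k l : ℕ) (S : Finset (Sph 1)) (c : Sph 1 → ℝ)
    (Z : Finset (Sph m)) (d : Sph m → ℝ) :
    quadForm (zonalProd m k l) (S ×ˢ Z) (fun p => c p.1 * d p.2) =
      quadForm (zonalCircle k) S c * quadForm (fun z w => (sphPoly m l).eval (dotS z w)) Z d := by
  simp only [quadForm, zonalProd, zonalCircle, Finset.sum_product, Finset.sum_mul_sum]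
  refine Finset.sum_congr rfl fun x _ => Finset.sum_congr rfl fun z _ =>
    Finset.sum_congr rfl fun y _ => Finset.sum_congr rfl fun w _ => by ring

/-- Suppose the tail degenerates at weights `c`, and let `d` be the annihilating weights for `N`. On
`c ⊗ d` every term vanishes: through `d` when l < N or the parity is wrong, through `c` when `l`
belongs to the tail. Strictness on the product then forces c = 0. -/
lemma IsExpansion.isStrictPosDefKernel_tail {m : ℕ} {f : ℝ → ℝ → ℝ} {a : ℕ → ℕ → ℝ} {Λ : Type*}
    {e : Λ → ℕ} (h : IsExpansion m f a) (hm : 2 ≤ m) (he : Function.Injective e) {N : ℕ}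
    (hN : 0 < N) (heN : ∀ l, N ≤ l → l % 2 = N % 2 → l ∈ Set.range e)
    (hf : IsStrictPosDefKernel (prodKernel m f)) :
    IsStrictPosDefKernel fun x y : Sph 1 => tail a e (dotS x y) := by
  refine (h.isPosDefKernel_tail hm he).isStrictPosDefKernel fun S c h0 x hx => ?_
  rw [h.quadForm_tail_eq_zero_iff hm he] at h0
  obtain ⟨Z, d, ⟨z, hz, hdz⟩, hZ⟩ := exists_annihilating_weights (m := m) (by omega) hN
  have := hf.eq_zero (S := S ×ˢ Z) (c := fun p => c p.1 * d p.2) (by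
    rw [h.quadForm_eq_zero_iff (by omega)]
    intro k l hkl
    rw [quadForm_zonalProd_product]
    by_cases hl : l < N ∨ l % 2 ≠ N % 2
    · rw [hZ l hl, mul_zero]
    · push Not at hl
      obtain ⟨i, rfl⟩ := heN l hl.1 hl.2
      rw [h0 k i hkl, zero_mul]) (x, z) (Finset.mem_product.2 ⟨hx, hz⟩)
  exact (mul_eq_zero.1 this).resolve_right hdz

/-! ### Antipodal symmetrization: (ii) implies (i) -/

section Antipodal

variable {m l : ℕ} {P : ℝ[X]} {B : Finset (Sph m)}

lemma sum_add_antipodal_mul (hB : ∀ z ∈ B, -z ∈ B) {s : ℝ} (U : Sph m → ℝ)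
    {G : Sph m → ℝ} (hG : ∀ z, G (-z) = s * G z) :
    ∑ z ∈ B, (U z + s * U (-z)) * G z = 2 * ∑ z ∈ B, U z * G z := by
  have h : ∑ z ∈ B, s * U (-z) * G z = ∑ z ∈ B, U z * G z := by
    refine Finset.sum_nbij' (fun z => -z) (fun z => -z) hB hB (by simp) (by simp) fun z _ => ?_
    rw [hG]; ring
  simp only [add_mul, Finset.sum_add_distrib, h]
  ring

/-- Diagonal dominance after symmetrization. A kernel of parity (-1)^l sees only the part of `U` of
that parity, so `U` itself cannot be bounded. -/
lemma IsZonal.antipodal_sum_sq_le (h : IsZonal m l P) (hB : ∀ z ∈ B, -z ∈ B)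
    (h1 : 0 ≤ P.eval 1)
    (hdec : ∀ z ∈ B, ∀ w ∈ B, w ≠ z → w ≠ -z → |P.eval (dotS z w)| * (2 * B.card) ≤ P.eval 1)
    (U : Sph m → ℝ) :
    P.eval 1 * ∑ z ∈ B, (U z + (-1) ^ l * U (-z)) ^ 2 ≤
      8 * quadForm (fun z w => P.eval (dotS z w)) B U := by
  set s : ℝ := (-1) ^ l with hs
  have hss : s * s = 1 := by rw [hs, ← mul_pow]; norm_num
  set V : Sph m → ℝ := fun z => U z + s * U (-z) with hV
  have hVneg : ∀ z, V (-z) = s * V z := fun z => by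
    simp only [hV, neg_neg]
    linear_combination (-U (-z)) * hss
  have hPl : ∀ z w : Sph m, P.eval (dotS (-z) w) = s * P.eval (dotS z w) := fun z w => by
    rw [dotS_neg_left, h.eval_neg]
  have hPr : ∀ z w : Sph m, P.eval (dotS z (-w)) = s * P.eval (dotS z w) := fun z w => by
    rw [dotS_neg_right, h.eval_neg]
  -- Symmetrizing doubles the sum in each of the two variables, whence the factor 4.
  have e1 : quadForm (fun z w => P.eval (dotS z w)) B V =
      4 * quadForm (fun z w => P.eval (dotS z w)) B U := by
    have a1 : quadForm (fun z w => P.eval (dotS z w)) B V =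
        ∑ z ∈ B, V z * ∑ w ∈ B, V w * P.eval (dotS z w) := by
      simp only [quadForm, Finset.mul_sum, mul_assoc]
    have a2 : quadForm (fun z w => P.eval (dotS z w)) B U =
        ∑ z ∈ B, U z * ∑ w ∈ B, U w * P.eval (dotS z w) := by
      simp only [quadForm, Finset.mul_sum, mul_assoc]
    have a3 : ∀ z, ∑ w ∈ B, V w * P.eval (dotS z w) = 2 * ∑ w ∈ B, U w * P.eval (dotS z w) :=
      fun z => sum_add_antipodal_mul hB U fun w => hPr z w
    rw [a1, a2, sum_add_antipodal_mul hB U (fun z => by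
      simp only [Finset.mul_sum, hPl]
      exact Finset.sum_congr rfl fun w _ => by ring)]
    simp only [a3, Finset.mul_sum]
    exact Finset.sum_congr rfl fun z _ => Finset.sum_congr rfl fun w _ => by ring
  rcases B.eq_empty_or_nonempty with rfl | hne
  · simp [quadForm]
  have hcard : (0 : ℝ) < B.card := by exact_mod_cast hne.card_pos
  -- The antipodal entry w = -z is not small, but it is nonnegative: the two signs (-1)^l, from V
  -- and from the polynomial, cancel.
  have e2 : ∀ z ∈ B, ∀ w ∈ B, (if w = z then V z ^ 2 * P.eval 1 else 0)
      - P.eval 1 / (4 * B.card) * (V z ^ 2 + V w ^ 2) ≤ V z * V w * P.eval (dotS z w) := by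
    intro z hz w hw
    have hnn : 0 ≤ P.eval 1 / (4 * B.card) * (V z ^ 2 + V w ^ 2) := by positivity
    split_ifs with hwz
    · subst hwz
      rw [dotS_self, ← sq]; linarith
    · by_cases hwn : w = -z
      · subst hwn
        rw [hVneg, hPr, dotS_self]
        have : V z * (s * V z) * (s * P.eval 1) = V z ^ 2 * P.eval 1 := by
          linear_combination (V z ^ 2 * P.eval 1) * hss
        rw [this]
        have : 0 ≤ V z ^ 2 * P.eval 1 := by positivity
        rw [hVneg] at hnn
        linarith
      · have hd := hdec z hz w hw hwz hwn
        have hd' : |P.eval (dotS z w)| ≤ 2 * (P.eval 1 / (4 * B.card)) := by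
          rw [show 2 * (P.eval 1 / (4 * B.card)) = P.eval 1 / (2 * B.card) by ring,
            le_div_iff₀ (by positivity)]
          exact hd
        set κ := P.eval 1 / (4 * B.card)
        have h3 : |V z * V w| * |P.eval (dotS z w)| ≤ (V z ^ 2 + V w ^ 2) / 2 * (2 * κ) := by
          refine mul_le_mul ?_ hd' (abs_nonneg _) (by positivity)
          rw [abs_le]
          constructor <;> nlinarith [sq_nonneg (V z + V w), sq_nonneg (V z - V w)]
        rw [← abs_mul] at h3
        have := neg_abs_le (V z * V w * P.eval (dotS z w))
        linarith
  -- Summed over all pairs, the error terms use up exactly half of the diagonal.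
  have e3 : P.eval 1 / 2 * ∑ z ∈ B, V z ^ 2 ≤ quadForm (fun z w => P.eval (dotS z w)) B V := by
    refine le_trans (le_of_eq ?_)
      (Finset.sum_le_sum fun z hz => Finset.sum_le_sum fun w hw => e2 z hz w hw)
    have b1 : ∀ z ∈ B, ∑ w ∈ B, ((if w = z then V z ^ 2 * P.eval 1 else 0)
        - P.eval 1 / (4 * B.card) * (V z ^ 2 + V w ^ 2)) = V z ^ 2 * P.eval 1
          - P.eval 1 / (4 * B.card) * (B.card * V z ^ 2 + ∑ w ∈ B, V w ^ 2) := by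
      intro z hz
      rw [Finset.sum_sub_distrib, Finset.sum_ite_eq' B z, if_pos hz, ← Finset.mul_sum,
        Finset.sum_add_distrib, Finset.sum_const, nsmul_eq_mul]
    rw [Finset.sum_congr rfl b1, Finset.sum_sub_distrib, ← Finset.sum_mul, ← Finset.mul_sum,
      Finset.sum_add_distrib, ← Finset.mul_sum, Finset.sum_const, nsmul_eq_mul]
    field_simp
    ring
  rw [e1] at e3
  linarith

end Antipodal

/-- Features of the circle factor split the form into forms of P_l^m on `B`, one for each feature.
Each must vanish, and diagonal dominance then annihilates the symmetrized feature sums at every `z`.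
-/
lemma quadForm_zonalCircle_eq_zero_of_zonalProd {m k l : ℕ} (hm : 2 ≤ m) {A : Finset (Sph 1)}
    {B : Finset (Sph m)} (hB : ∀ z ∈ B, -z ∈ B)
    (hdec : ∀ z ∈ B, ∀ w ∈ B, w ≠ z → w ≠ -z →
      |(sphPoly m l).eval (dotS z w)| * (2 * B.card) ≤ (sphPoly m l).eval 1)
    {c : Sph 1 × Sph m → ℝ} (h0 : quadForm (zonalProd m k l) (A ×ˢ B) c = 0)
    {z : Sph m} (hz : z ∈ B) :
    quadForm (zonalCircle k) A (fun x => c (x, z) + (-1) ^ l * c (x, -z)) = 0 := by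
  obtain ⟨F, φ, hφ⟩ := (isZonal_sphPoly le_rfl k).exists_features
  have hp := sphPoly_eval_one_pos (m := m) (by omega) l
  have hP := isZonal_sphPoly (m := m) (by omega) l
  set U : (Fin (1 + 1) →₀ ℕ) → Sph m → ℝ := fun a z => ∑ x ∈ A, c (x, z) * φ a x with hU
  have e1 : quadForm (zonalProd m k l) (A ×ˢ B) c =
      ∑ a ∈ F, quadForm (fun z w => (sphPoly m l).eval (dotS z w)) B (U a) := by
    have h1 : zonalProd m k l = fun p q => (fun p q : Sph 1 × Sph m =>
        (sphPoly m l).eval (dotS p.2 q.2)) p q * ∑ a ∈ F, φ a p.1 * φ a q.1 := by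
      funext p q
      rw [zonalProd, hφ, mul_comm]
    rw [h1, quadForm_mul_features F (fun a (p : Sph 1 × Sph m) => φ a p.1)]
    refine Finset.sum_congr rfl fun a _ => ?_
    simp only [quadForm, hU, Finset.sum_product_right, Finset.sum_mul_sum]
    simp only [Finset.sum_mul]
    refine Finset.sum_congr rfl fun z _ => ?_
    rw [Finset.sum_comm]
  have e2 : ∀ a ∈ F, quadForm (fun z w => (sphPoly m l).eval (dotS z w)) B (U a) = 0 :=
    (Finset.sum_eq_zero_iff_of_nonneg fun a _ => hP.quadForm_nonneg B (U a)).1 (e1 ▸ h0)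
  unfold zonalCircle
  simp only [hφ]
  rw [quadForm_features]
  refine Finset.sum_eq_zero fun a ha => ?_
  have h3 := hP.antipodal_sum_sq_le hB hp.le hdec (U a)
  rw [e2 a ha, mul_zero] at h3
  have h4 : ∑ z ∈ B, (U a z + (-1) ^ l * U a (-z)) ^ 2 ≤ 0 := by
    by_contra! hc
    exact absurd h3 (not_le.2 (mul_pos hp hc))
  have h5 : ∑ z ∈ B, (U a z + (-1) ^ l * U a (-z)) ^ 2 = 0 :=
    le_antisymm h4 (Finset.sum_nonneg fun _ _ => sq_nonneg _)
  have h6 := (Finset.sum_eq_zero_iff_of_nonneg fun _ _ => sq_nonneg _).1 h5 z hz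
  rw [← h6]
  simp only [hU, add_mul, Finset.sum_add_distrib, Finset.mul_sum, mul_assoc]

open Filter in
lemma eventually_offDiagonal_le {m : ℕ} (hm : 2 ≤ m) (B : Finset (Sph m)) :
    ∀ᶠ l in atTop, ∀ z ∈ B, ∀ w ∈ B, w ≠ z → w ≠ -z →
      |(sphPoly m l).eval (dotS z w)| * (2 * B.card) ≤ (sphPoly m l).eval 1 := by
  rw [Filter.eventually_all_finset]
  intro z hz
  rw [Filter.eventually_all_finset]
  intro w hw
  by_cases h1 : w = z
  · exact Eventually.of_forall fun _ h => absurd h1 h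
  by_cases h2 : w = -z
  · exact Eventually.of_forall fun _ _ h => absurd h2 h
  have hcard : (0 : ℝ) < 2 * B.card := by
    have : 0 < B.card := Finset.card_pos.2 ⟨z, hz⟩
    positivity
  have ht := (tendsto_sphPoly_div hm (dotS_sq_lt_one h1 h2)).abs
  rw [abs_zero] at ht
  filter_upwards [ht.eventually_le_const (inv_pos.2 hcard)] with l hl _ _
  have hp := sphPoly_eval_one_pos (m := m) (by omega) l
  rw [abs_div, abs_of_pos hp, div_le_iff₀ hp, inv_mul_eq_div, le_div_iff₀ hcard] at hl
  exact hl

variable {m : ℕ} {f : ℝ → ℝ → ℝ} {a : ℕ → ℕ → ℝ}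

lemma IsExpansion.isStrictPosDefKernel_prodKernel (h : IsExpansion m f a) (hm : 2 ≤ m)
    (hf : IsPosDefKernel (prodKernel m f))
    (H : ∀ γ : ℕ, IsStrictPosDefKernel (fun x y : Sph 1 => oddTail a γ (dotS x y)) ∧
      IsStrictPosDefKernel (fun x y : Sph 1 => evenTail a γ (dotS x y))) :
    IsStrictPosDefKernel (prodKernel m f) := by
  classical
  refine hf.isStrictPosDefKernel fun S c h0 => ?_
  set A := S.image Prod.fst with hA
  -- Antipodes are added so that symmetrization stays inside `B`; the weights `d` are zero at the
  -- new points of the product.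
  set B := S.image Prod.snd ∪ S.image (fun p => -p.2) with hB
  set d : Sph 1 × Sph m → ℝ := fun p => if p ∈ S then c p else 0 with hd
  have hSAB : S ⊆ A ×ˢ B := fun p hp => Finset.mem_product.2
    ⟨Finset.mem_image_of_mem _ hp, Finset.mem_union_left _ (Finset.mem_image_of_mem _ hp)⟩
  have hBneg : ∀ z ∈ B, -z ∈ B := by
    intro z hz
    rcases Finset.mem_union.1 hz with hz | hz
    · obtain ⟨p, hp, rfl⟩ := Finset.mem_image.1 hz
      exact Finset.mem_union_right _ (Finset.mem_image.2 ⟨p, hp, rfl⟩)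
    · obtain ⟨p, hp, rfl⟩ := Finset.mem_image.1 hz
      rw [neg_neg]
      exact Finset.mem_union_left _ (Finset.mem_image.2 ⟨p, hp, rfl⟩)
  rw [← quadForm_congr_of_subset hSAB (d := d) (fun p hp => if_pos hp) (fun p _ hp => if_neg hp),
    h.quadForm_eq_zero_iff (by omega)] at h0
  obtain ⟨γ, hγ⟩ := Filter.eventually_atTop.1 (eventually_offDiagonal_le hm B)
  intro p hp
  obtain ⟨hpA, hpB⟩ := Finset.mem_product.1 (hSAB hp)
  -- The degrees in the tail are at least `γ`, hence large enough for the off-diagonal bound on `B`.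
  have hodd := (H γ).1.eq_zero (S := A) (c := fun x => d (x, p.2) + -1 * d (x, -p.2))
    ((h.quadForm_tail_eq_zero_iff hm (e := fun l : {l : ℕ // γ ≤ 2 * l + 1} => 2 * l.1 + 1)
      (fun i j hij => Subtype.ext (by simpa using hij)) _ _).2 fun k l hkl => by
        have := quadForm_zonalCircle_eq_zero_of_zonalProd hm hBneg (hγ _ l.2) (h0 _ _ hkl) hpB
        rwa [pow_succ, pow_mul, neg_one_sq, one_pow, one_mul] at this) p.1 hpA
  have heven := (H γ).2.eq_zero (S := A) (c := fun x => d (x, p.2) + d (x, -p.2))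
    ((h.quadForm_tail_eq_zero_iff hm (e := fun l : {l : ℕ // γ ≤ 2 * l} => 2 * l.1)
      (fun i j hij => Subtype.ext (by simpa using hij)) _ _).2 fun k l hkl => by
        have := quadForm_zonalCircle_eq_zero_of_zonalProd hm hBneg (hγ _ l.2) (h0 _ _ hkl) hpB
        simpa [pow_mul] using this) p.1 hpA
  have hdp : d p = c p := if_pos hp
  rw [← hdp]
  simp only [Prod.mk.eta] at hodd heven
  linarith

lemma IsExpansion.isStrictPosDefKernel_iff (h : IsExpansion m f a) (hm : 2 ≤ m)
    (hf : IsPosDefKernel (prodKernel m f)) :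
    IsStrictPosDefKernel (prodKernel m f) ↔
      ∀ γ : ℕ, GeneratesStrictPosDefCircle (oddTail a γ) ∧
        GeneratesStrictPosDefCircle (evenTail a γ) := by
  constructor
  · intro hs γ
    have hodd : Function.Injective fun l : {l : ℕ // γ ≤ 2 * l + 1} => 2 * l.1 + 1 :=
      fun i j hij => Subtype.ext (by simpa using hij)
    have heven : Function.Injective fun l : {l : ℕ // γ ≤ 2 * l} => 2 * l.1 :=
      fun i j hij => Subtype.ext (by simpa using hij)
    refine ⟨⟨h.continuousOn_tail hm hodd, ?_⟩, ⟨h.continuousOn_tail hm heven, ?_⟩⟩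
    -- `N` only has to be positive, at least `γ` and of the right parity; hence `2 * γ + 1` here and
    -- `2 * γ + 2` for the even tail.
    · exact h.isStrictPosDefKernel_tail hm hodd (N := 2 * γ + 1) (by omega)
        (fun l h1 h2 => ⟨⟨l / 2, by omega⟩, by simp only; omega⟩) hs
    · exact h.isStrictPosDefKernel_tail hm heven (N := 2 * γ + 2) (by omega)
        (fun l h1 h2 => ⟨⟨l / 2, by omega⟩, by simp only; omega⟩) hs
  · exact fun H => h.isStrictPosDefKernel_prodKernel hm hf fun γ => ⟨(H γ).1.2, (H γ).2.2⟩

/-! ### Rotation invariant measure, moments and orthogonality -/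

section SphereMeasure

open MeasureTheory Set

-- The measure of a set is a multiple of the volume of the cone over it, and linear isometries
-- preserve volume.
open scoped Pointwise in
lemma toSphere_map_linearIsometryEquiv {E : Type*} [NormedAddCommGroup E] [InnerProductSpace ℝ E]
    [FiniteDimensional ℝ E] [MeasurableSpace E] [BorelSpace E] (g : E ≃ₗᵢ[ℝ] E)
    {φ : Metric.sphere (0 : E) 1 → Metric.sphere (0 : E) 1} (hφ : ∀ x, (φ x : E) = g x) :
    Measure.map φ (volume : Measure E).toSphere = (volume : Measure E).toSphere := by
  have hm : Measurable φ := by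
    have : Continuous φ := by
      rw [continuous_induced_rng]
      exact (g.continuous.comp continuous_subtype_val).congr fun x => (hφ x).symm
    exact this.measurable
  ext s hs
  rw [Measure.map_apply hm hs, Measure.toSphere_apply' _ (hm hs), Measure.toSphere_apply' _ hs]
  congr 1
  rw [← g.measurePreserving.measure_preimage_emb g.toHomeomorph.measurableEmbedding
    (Ioo (0 : ℝ) 1 • (Subtype.val '' s))]
  congr 1
  ext v
  simp only [Set.mem_smul, Set.mem_image, Set.mem_preimage]
  constructor
  · rintro ⟨r, hr, _, ⟨x, hx, rfl⟩, rfl⟩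
    exact ⟨r, hr, _, ⟨φ x, hx, rfl⟩, by rw [hφ, map_smul]⟩
  · rintro ⟨r, hr, _, ⟨y, hy, rfl⟩, hv⟩
    have hy' : g.symm y ∈ Metric.sphere (0 : E) 1 := by
      rw [mem_sphere_zero_iff_norm, g.symm.norm_map]; simp
    refine ⟨r, hr, _, ⟨⟨g.symm y, hy'⟩, ?_, rfl⟩, ?_⟩
    · have : φ ⟨g.symm y, hy'⟩ = y := Subtype.ext (by rw [hφ]; simp)
      rwa [this]
    · apply g.injective
      rw [← hv, map_smul]
      simp

/-- The normalized rotation invariant measure on `S^m`. -/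
def sphMeasure (m : ℕ) : Measure (Sph m) :=
  ((volume : Measure (EuclideanSpace ℝ (Fin (m + 1)))).toSphere univ)⁻¹ •
    (volume : Measure (EuclideanSpace ℝ (Fin (m + 1)))).toSphere

variable {m : ℕ}

instance : IsProbabilityMeasure (sphMeasure m) := by
  refine ⟨?_⟩
  rw [sphMeasure, Measure.smul_apply, smul_eq_mul, ENNReal.inv_mul_cancel]
  · rw [Ne, Measure.measure_univ_eq_zero]; exact Measure.toSphere_ne_zero _
  · exact measure_ne_top _ _

instance : (sphMeasure m).IsOpenPosMeasure :=
  Measure.isOpenPosMeasure_smul _ (ENNReal.inv_ne_zero.2 (measure_ne_top _ _))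

/-- The inner product of two points of `S^m`, as a point of `[-1, 1]`. -/
def dotI (x y : Sph m) : Icc (-1 : ℝ) 1 := ⟨dotS x y, dotS_mem_Icc x y⟩

lemma continuous_dotI : Continuous fun p : Sph m × Sph m => dotI p.1 p.2 := by
  rw [continuous_induced_rng]
  exact (continuous_subtype_val.comp continuous_fst).inner
    (continuous_subtype_val.comp continuous_snd)

lemma continuous_dotI_right (x : Sph m) : Continuous (dotI x) :=
  continuous_dotI.comp (Continuous.prodMk_right x)

lemma exists_linearIsometryEquiv_map (x y : Sph m) :
    ∃ g : EuclideanSpace ℝ (Fin (m + 1)) ≃ₗᵢ[ℝ] EuclideanSpace ℝ (Fin (m + 1)), g x = y :=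
  ⟨_, Submodule.reflection_sub (by rw [norm_sph, norm_sph])⟩

lemma map_dotI_eq (x y : Sph m) :
    (sphMeasure m).map (dotI x) = (sphMeasure m).map (dotI y) := by
  obtain ⟨g, hg⟩ := exists_linearIsometryEquiv_map x y
  set φ : Sph m → Sph m := fun z => ⟨g z, by
    rw [mem_sphere_zero_iff_norm, g.norm_map]; simp⟩ with hφ
  have hc : Continuous φ := by
    rw [continuous_induced_rng]
    exact g.continuous.comp continuous_subtype_val
  have h1 : (sphMeasure m).map φ = sphMeasure m := by
    rw [sphMeasure, Measure.map_smul, toSphere_map_linearIsometryEquiv g fun _ => rfl]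
  have h2 : dotI x = dotI y ∘ φ := by
    funext z
    refine Subtype.ext ?_
    change inner ℝ _ _ = inner ℝ _ (g z)
    rw [← hg, g.inner_map_map]
  rw [h2, ← Measure.map_map (continuous_dotI_right y).measurable hc.measurable, h1]

/-- The first basis vector, as a point of `S^m`. -/
def basePoint (m : ℕ) : Sph m := ⟨EuclideanSpace.single 0 1, by simp⟩

/-- The distribution of `x ⋅ y` on `[-1, 1]` for `y` uniformly distributed on `S^m`. -/
def dotMeasure (m : ℕ) : Measure (Icc (-1 : ℝ) 1) := (sphMeasure m).map (dotI (basePoint m))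

lemma map_dotI (x : Sph m) : (sphMeasure m).map (dotI x) = dotMeasure m := map_dotI_eq _ _

instance : IsProbabilityMeasure (dotMeasure m) :=
  Measure.isProbabilityMeasure_map (continuous_dotI_right _).measurable.aemeasurable

lemma isOpenPosMeasure_dotMeasure (hm : 1 ≤ m) : (dotMeasure m).IsOpenPosMeasure := by
  refine ⟨fun U hU ⟨s, hs⟩ => ?_⟩
  obtain ⟨x, y, hxy⟩ := exists_dotS_eq hm s.2
  rw [← map_dotI x, Measure.map_apply (continuous_dotI_right x).measurable hU.measurableSet]
  refine (hU.preimage (continuous_dotI_right x)).measure_ne_zero _ ⟨y, ?_⟩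
  have : dotI x y = s := Subtype.ext hxy
  rwa [mem_preimage, this]

lemma integral_dotI (x : Sph m) {g : Icc (-1 : ℝ) 1 → ℝ} (hg : Continuous g) :
    ∫ z, g (dotI x z) ∂sphMeasure m = ∫ t, g t ∂dotMeasure m := by
  rw [← map_dotI x, integral_map (continuous_dotI_right x).measurable.aemeasurable
    hg.aestronglyMeasurable]

lemma integrable_of_compactSpace {X : Type*} [TopologicalSpace X] [CompactSpace X]
    [MeasurableSpace X] [OpensMeasurableSpace X] {μ : Measure X} [IsFiniteMeasure μ] {g : X → ℝ}
    (hg : Continuous g) : Integrable g μ :=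
  hg.integrable_of_hasCompactSupport (HasCompactSupport.of_compactSpace g)

/-- Integration of polynomials against `dotMeasure m`. -/
def dotFunctional (m : ℕ) : ℝ[X] →ₗ[ℝ] ℝ where
  toFun p := ∫ t, p.eval (t : ℝ) ∂dotMeasure m
  map_add' p q := by
    simp only [eval_add]
    exact integral_add (integrable_of_compactSpace (p.continuous.comp continuous_subtype_val))
      (integrable_of_compactSpace (q.continuous.comp continuous_subtype_val))
  map_smul' c p := by
    simp only [eval_smul, RingHom.id_apply]
    exact integral_smul c _

lemma dotFunctional_apply (p : ℝ[X]) :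
    dotFunctional m p = ∫ t, p.eval (t : ℝ) ∂dotMeasure m := rfl

lemma dotFunctional_eq_integral (p : ℝ[X]) (x : Sph m) :
    dotFunctional m p = ∫ z, p.eval (dotS x z) ∂sphMeasure m :=
  (integral_dotI x (g := fun t => p.eval (t : ℝ))
    (p.continuous.comp continuous_subtype_val)).symm

lemma dotS_basePoint (z : Sph m) : dotS (basePoint m) z = z.1 0 := by
  simp [dotS, basePoint, EuclideanSpace.inner_single_left]

lemma dotFunctional_X_pow_odd {n : ℕ} (hn : Odd n) : dotFunctional m (X ^ n) = 0 := by
  have h1 := dotFunctional_eq_integral (X ^ n) (basePoint m)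
  have h2 := dotFunctional_eq_integral (X ^ n) (-basePoint m)
  simp only [eval_pow, eval_X, dotS_neg_left, hn.neg_pow, integral_neg] at h1 h2
  linarith

lemma continuous_coord (i : Fin (m + 1)) : Continuous fun z : Sph m => z.1 i :=
  (EuclideanSpace.proj (𝕜 := ℝ) i).continuous.comp continuous_subtype_val

lemma integral_coord_add_pow {i : Fin (m + 1)} (hi : i ≠ 0) (p : ℕ) (ε : ℝ) :
    ∫ z : Sph m, (z.1 0 + ε * z.1 i) ^ (2 * p) ∂sphMeasure m =
      (1 + ε ^ 2) ^ p * dotFunctional m (X ^ (2 * p)) := by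
  have hpos : 0 < 1 + ε ^ 2 := by positivity
  set r := Real.sqrt (1 + ε ^ 2) with hr
  have hr0 : 0 < r := Real.sqrt_pos.2 hpos
  have hr2 : r ^ 2 = 1 + ε ^ 2 := Real.sq_sqrt hpos.le
  set v : EuclideanSpace ℝ (Fin (m + 1)) :=
    EuclideanSpace.single 0 (1 : ℝ) + EuclideanSpace.single i ε with hv
  have hvn : ‖v‖ = r := by
    rw [← sq_eq_sq₀ (norm_nonneg _) hr0.le, ← real_inner_self_eq_norm_sq, hr2, hv,
      inner_add_left, EuclideanSpace.inner_single_left, EuclideanSpace.inner_single_left]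
    simp [hi, hi.symm, sq]
  set x : Sph m := ⟨r⁻¹ • v, by
    rw [mem_sphere_zero_iff_norm, norm_smul, hvn, Real.norm_of_nonneg (inv_nonneg.2 hr0.le),
      inv_mul_cancel₀ hr0.ne']⟩ with hx
  have hdot (z : Sph m) : z.1 0 + ε * z.1 i = r * dotS x z := by
    rw [dotS, hx]
    simp only [inner_smul_left, hv, inner_add_left, EuclideanSpace.inner_single_left]
    simp
    field_simp
  simp only [hdot, mul_pow]
  rw [integral_const_mul, dotFunctional_eq_integral _ x, pow_mul, hr2]
  simp

/-- By rotation invariance the moment of z_0 + ε z_i depends on ε only through (1 + ε²)^(p+1); the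
coefficients of ε² are compared. -/
lemma dotFunctional_even_succ {i : Fin (m + 1)} (hi : i ≠ 0) (p : ℕ) :
    (2 * (p : ℝ) + 1) * ∫ z : Sph m, z.1 0 ^ (2 * p) * z.1 i ^ 2 ∂sphMeasure m =
      dotFunctional m (X ^ (2 * (p + 1))) := by
  set n := 2 * (p + 1) with hn
  set c : ℕ → ℝ := fun k => ∫ z : Sph m, z.1 0 ^ (n - k) * z.1 i ^ k ∂sphMeasure m with hc
  have hInt (k j : ℕ) : Integrable (fun z : Sph m => z.1 0 ^ j * z.1 i ^ k) (sphMeasure m) :=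
    integrable_of_compactSpace (((continuous_coord 0).pow j).mul ((continuous_coord i).pow k))
  have hpoly : ∑ k ∈ Finset.range (n + 1), C (c k * n.choose k) * X ^ k =
      C (dotFunctional m (X ^ n)) * expand ℝ 2 ((1 + X) ^ (p + 1)) := by
    refine Polynomial.funext fun ε => ?_
    have h := integral_coord_add_pow hi (p + 1) ε
    rw [← hn] at h
    simp only [eval_finsetSum, eval_mul, eval_C, eval_pow, eval_X, expand_eval, eval_add, eval_one]
    rw [mul_comm (dotFunctional m (X ^ n)), ← h]
    have hexp (z : Sph m) : (z.1 0 + ε * z.1 i) ^ n = ∑ k ∈ Finset.range (n + 1),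
        (n.choose k * ε ^ k) * (z.1 0 ^ (n - k) * z.1 i ^ k) := by
      rw [add_comm (z.1 0), add_pow]
      refine Finset.sum_congr rfl fun k _ => ?_
      rw [mul_pow]; ring
    simp only [hexp]
    rw [integral_finsetSum _ fun k _ => (hInt k _).const_mul _]
    refine Finset.sum_congr rfl fun k _ => ?_
    rw [integral_const_mul]
    ring
  have h2 := congrArg (fun q => q.coeff 2) hpoly
  simp only [finsetSum_coeff, coeff_C_mul, coeff_X_pow, coeff_expand two_pos] at h2
  rw [Finset.sum_eq_single 2 (fun k _ hk => by simp [hk.symm]) (fun h => by simp at h; omega)] at h2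
  simp only [if_true, dvd_refl, Nat.div_self two_pos, mul_one, coeff_one_add_X_pow,
    Nat.choose_one_right] at h2
  have hch : (n.choose 2 : ℝ) = (p + 1) * (2 * p + 1) := by
    rw [Nat.cast_choose_two, hn]; push_cast; ring
  have hc2 : c 2 = ∫ z : Sph m, z.1 0 ^ (2 * p) * z.1 i ^ 2 ∂sphMeasure m := by
    simp only [hc, hn]; rfl
  rw [hch, hc2] at h2
  have hp : (p : ℝ) + 1 ≠ 0 := by positivity
  apply mul_left_cancel₀ hp
  push_cast at h2
  linarith

/-- For even exponents, sum the preceding identity over the `m` coordinates other than z_0, whose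
squares add up to 1 - z_0². Odd moments vanish by symmetry. -/
lemma dotFunctional_X_pow (n : ℕ) :
    ((n : ℝ) + 1) * (dotFunctional m (X ^ n) - dotFunctional m (X ^ (n + 2))) =
      m * dotFunctional m (X ^ (n + 2)) := by
  rcases Nat.even_or_odd' n with ⟨p, rfl | rfl⟩
  · have hz (z : Sph m) : ∑ i : Fin m, z.1 0 ^ (2 * p) * z.1 i.succ ^ 2 =
        z.1 0 ^ (2 * p) - z.1 0 ^ (2 * p + 2) := by
      have h := dotS_self z
      rw [dotS_eq_sum, Fin.sum_univ_succ] at h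
      rw [← Finset.mul_sum]
      simp only [sq]
      rw [pow_add]
      linear_combination (z.1 0 ^ (2 * p)) * h
    have h1 := Finset.sum_congr rfl fun (i : Fin m) (_ : i ∈ Finset.univ) =>
      dotFunctional_even_succ (m := m) (Fin.succ_ne_zero i) p
    have hInt (i : Fin m) : Integrable (fun z : Sph m => z.1 0 ^ (2 * p) * z.1 i.succ ^ 2)
        (sphMeasure m) :=
      integrable_of_compactSpace (((continuous_coord 0).pow _).mul ((continuous_coord _).pow _))
    have hInt' (k : ℕ) : Integrable (fun z : Sph m => z.1 0 ^ k) (sphMeasure m) :=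
      integrable_of_compactSpace ((continuous_coord 0).pow k)
    rw [← Finset.mul_sum, ← integral_finsetSum _ fun i _ => hInt i] at h1
    simp only [hz] at h1
    rw [integral_sub (hInt' _) (hInt' _)] at h1
    have h2 (k : ℕ) : dotFunctional m (X ^ k) = ∫ z : Sph m, z.1 0 ^ k ∂sphMeasure m := by
      rw [dotFunctional_eq_integral _ (basePoint m)]
      simp [dotS_basePoint]
    rw [← h2, ← h2, Finset.sum_const, Finset.card_univ, Fintype.card_fin, nsmul_eq_mul] at h1
    push_cast
    exact h1
  · rw [dotFunctional_X_pow_odd ⟨p, rfl⟩, dotFunctional_X_pow_odd ⟨p + 1, by ring⟩]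
    simp

/-- This is integration by parts against the weight (1 - t²)^(m/2 - 1), obtained from the moment
recurrence without computing a density. -/
lemma dotFunctional_divergence (r : ℝ[X]) :
    dotFunctional m ((1 - X ^ 2) * derivative r - C (m : ℝ) * X * r) = 0 := by
  induction r using Polynomial.induction_on' with
  | add p q hp hq =>
    have e : (1 - X ^ 2) * derivative (p + q) - C (m : ℝ) * X * (p + q) =
        ((1 - X ^ 2) * derivative p - C (m : ℝ) * X * p)
          + ((1 - X ^ 2) * derivative q - C (m : ℝ) * X * q) := by
      rw [derivative_add]; ring
    rw [e, map_add, hp, hq, add_zero]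
  | monomial n c =>
    have h : (1 - X ^ 2) * derivative (monomial n c) - C (m : ℝ) * X * monomial n c =
        c • ((1 - X ^ 2) * derivative (X ^ n) - (m : ℝ) • X ^ (n + 1)) := by
      rw [← C_mul_X_pow_eq_monomial, derivative_C_mul, smul_eq_C_mul, smul_eq_C_mul]
      ring
    rw [h, map_smul, map_sub, map_smul]
    cases n with
    | zero =>
      have : dotFunctional m (X ^ 1) = 0 := dotFunctional_X_pow_odd odd_one
      simp [pow_one] at this
      simp [this]
    | succ n =>
      have e : (1 - X ^ 2) * derivative (X ^ (n + 1)) =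
          ((n : ℝ) + 1) • X ^ n - ((n : ℝ) + 1) • (X ^ (n + 2) : ℝ[X]) := by
        rw [derivative_X_pow, smul_eq_C_mul, smul_eq_C_mul]
        simp only [Nat.add_sub_cancel, map_add, map_natCast, C_1]
        push_cast
        ring
      rw [e, map_sub, map_smul, map_smul]
      have := dotFunctional_X_pow (m := m) n
      simp only [smul_eq_mul] at this ⊢
      rw [← mul_sub, this, sub_self, mul_zero]

/-- Apply the divergence identity to the Wronskian: the differential equations turn it into the
difference of eigenvalues times `P * Q`. -/
lemma IsZonal.dotFunctional_mul_eq_zero (hm : 1 ≤ m) {k l : ℕ} {P Q : ℝ[X]} (hP : IsZonal m k P)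
    (hQ : IsZonal m l Q) (hkl : k ≠ l) : dotFunctional m (P * Q) = 0 := by
  have h := dotFunctional_divergence (m := m) (P * derivative Q - derivative P * Q)
  have e : (1 - X ^ 2) * derivative (P * derivative Q - derivative P * Q)
      - C (m : ℝ) * X * (P * derivative Q - derivative P * Q) =
      ((k : ℝ) * (k + m - 1) - l * (l + m - 1)) • (P * Q) := by
    rw [smul_eq_C_mul, C_sub]
    simp only [derivative_sub, derivative_mul]
    linear_combination P * hQ.ode - Q * hP.ode
  rw [e, map_smul, smul_eq_mul] at h
  refine (mul_eq_zero.1 h).resolve_left fun h0 => ?_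
  have h1 : ((k : ℝ) - l) * (k + l + m - 1) = 0 := by linear_combination h0
  have hm' : (1 : ℝ) ≤ m := by exact_mod_cast hm
  rcases mul_eq_zero.1 h1 with h2 | h2
  · exact hkl (by exact_mod_cast sub_eq_zero.1 h2)
  · have hk : (0 : ℝ) ≤ k := k.cast_nonneg
    have hl : (0 : ℝ) ≤ l := l.cast_nonneg
    have hk0 : (k : ℝ) = 0 := by linarith
    have hl0 : (l : ℝ) = 0 := by linarith
    exact hkl (by exact_mod_cast hk0.trans hl0.symm)

lemma dotFunctional_mul_self_pos (hm : 1 ≤ m) {P : ℝ[X]} (hP : P.eval 1 ≠ 0) :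
    0 < dotFunctional m (P * P) := by
  have := isOpenPosMeasure_dotMeasure hm
  rw [dotFunctional_apply]
  refine Continuous.integral_pos_of_hasCompactSupport_nonneg_nonzero
    (x := (⟨1, by norm_num⟩ : Icc (-1 : ℝ) 1))
    ((P * P).continuous.comp continuous_subtype_val) (HasCompactSupport.of_compactSpace _)
    (fun t => ?_) ?_
  · simp only [eval_mul]; exact mul_self_nonneg _
  · simpa using hP

end SphereMeasure

/-! ### Means of positive definite kernels -/

section Integral

open MeasureTheory ProbabilityTheory

/-- Points may repeat here, as random points can; multiplicities become the weights. -/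
lemma sum_fin_nonneg_of_quadForm {X : Type*} {K : X → X → ℝ} (hK : ∀ S c, 0 ≤ quadForm K S c)
    {n : ℕ} (x : Fin n → X) : 0 ≤ ∑ i, ∑ j, K (x i) (x j) := by
  classical
  have h : ∑ i, ∑ j, K (x i) (x j) = quadForm K (Finset.univ.image x)
      (fun p => ((Finset.univ.filter fun i => x i = p).card : ℝ)) := by
    rw [quadForm, Finset.sum_comp (fun p => ∑ j, K p (x j)) x]
    refine Finset.sum_congr rfl fun p _ => ?_
    rw [Finset.sum_comp (fun q => K p q) x, nsmul_eq_mul, Finset.mul_sum]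
    refine Finset.sum_congr rfl fun q _ => ?_
    rw [nsmul_eq_mul, mul_assoc]
  rw [h]
  exact hK _ _

/-- A continuous positive definite kernel has a nonnegative mean. -/
lemma integral_integral_nonneg_of_quadForm {X : Type*} [TopologicalSpace X] [CompactSpace X]
    [SecondCountableTopology X] [MeasurableSpace X] [BorelSpace X] (μ : Measure X)
    [IsProbabilityMeasure μ] {K : X → X → ℝ} (hc : Continuous fun p : X × X => K p.1 p.2)
    (hK : ∀ S c, 0 ≤ quadForm K S c) : 0 ≤ ∫ p, K p.1 p.2 ∂(μ.prod μ) := by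
  set J := ∫ p, K p.1 p.2 ∂(μ.prod μ) with hJ
  obtain ⟨M, hM⟩ := (isCompact_range hc).bddAbove
  have hM' : ∀ x y, K x y ≤ M := fun x y => hM ⟨(x, y), rfl⟩
  -- Take the expectation of the double sum over n + 1 independent points: off-diagonal terms have
  -- mean `J`, diagonal ones at most `M`. Letting n grow forces J ≥ 0.
  have key : ∀ n : ℕ, 0 ≤ (n : ℝ) * J + M := by
    intro n
    set N := n + 1
    set π : Measure (Fin N → X) := Measure.pi fun _ => μ
    have hcont (i j : Fin N) : Continuous fun ω : Fin N → X => K (ω i) (ω j) :=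
      hc.comp (f := fun ω : Fin N → X => (ω i, ω j)) (by fun_prop)
    have hInt (i j : Fin N) : Integrable (fun ω : Fin N → X => K (ω i) (ω j)) π :=
      integrable_of_compactSpace (hcont i j)
    have hne (i j : Fin N) (hij : i ≠ j) : ∫ ω, K (ω i) (ω j) ∂π = J := by
      have hind : iIndepFun (fun (i : Fin N) (ω : Fin N → X) => ω i) π :=
        iIndepFun_pi (X := fun _ x => x) fun _ => aemeasurable_id
      have hmi (i : Fin N) : Measurable fun ω : Fin N → X => ω i := measurable_pi_apply i
      have h1 := (indepFun_iff_map_prod_eq_prod_map_map (hmi i).aemeasurable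
        (hmi j).aemeasurable).1 (hind.indepFun hij)
      have h2 (i : Fin N) : π.map (fun ω => ω i) = μ :=
        (measurePreserving_eval (fun _ : Fin N => μ) i).map_eq
      rw [h2, h2] at h1
      rw [hJ, ← h1, integral_map ((hmi i).prodMk (hmi j)).aemeasurable hc.aestronglyMeasurable]
    have hdiag (i : Fin N) : ∫ ω, K (ω i) (ω i) ∂π ≤ M := by
      calc _ ≤ ∫ _, M ∂π := integral_mono (hInt i i) (integrable_const M) fun ω => hM' _ _
        _ = M := by simp
    have htot : 0 ≤ ∑ i, ∑ j, ∫ ω, K (ω i) (ω j) ∂π := by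
      have : ∑ i, ∑ j, ∫ ω, K (ω i) (ω j) ∂π = ∫ ω, ∑ i, ∑ j, K (ω i) (ω j) ∂π := by
        rw [integral_finsetSum _ fun i _ => integrable_finsetSum _ fun j _ => hInt i j]
        exact Finset.sum_congr rfl fun i _ => (integral_finsetSum _ fun j _ => hInt i j).symm
      rw [this]
      exact integral_nonneg fun ω => sum_fin_nonneg_of_quadForm hK ω
    have hrow (i : Fin N) : ∑ j, ∫ ω, K (ω i) (ω j) ∂π ≤ n * J + M := by
      rw [← Finset.add_sum_erase _ _ (Finset.mem_univ i),
        Finset.sum_congr rfl fun j hj => hne i j (Finset.ne_of_mem_erase hj).symm,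
        Finset.sum_const, Finset.card_erase_of_mem (Finset.mem_univ i), Finset.card_univ,
        Fintype.card_fin, nsmul_eq_mul, add_comm]
      have : ((N - 1 : ℕ) : ℝ) = n := by simp [N]
      rw [this]
      linarith [hdiag i]
    have h3 : 0 ≤ (N : ℝ) * (n * J + M) := by
      refine htot.trans ((Finset.sum_le_sum fun i _ => hrow i).trans (le_of_eq ?_))
      rw [Finset.sum_const, Finset.card_univ, Fintype.card_fin, nsmul_eq_mul]
    exact nonneg_of_mul_nonneg_right h3 (by positivity)
  by_contra! hneg
  obtain ⟨n, hn⟩ := exists_nat_gt (M / -J)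
  rw [div_lt_iff₀ (by linarith)] at hn
  linarith [key n]

/-- Multiplication by the kernel `L` preserves positive definiteness. -/
def PreservesPosDef {X : Type*} (L : X → X → ℝ) : Prop :=
  ∀ K : X → X → ℝ, (∀ S c, 0 ≤ quadForm K S c) → ∀ S c, 0 ≤ quadForm (fun p q => K p q * L p q) S c

lemma preservesPosDef_features {X α : Type*} (A : Finset α) (φ : α → X → ℝ) :
    PreservesPosDef fun p q => ∑ a ∈ A, φ a p * φ a q := fun K hK S c => by
  rw [quadForm_mul_features]
  exact Finset.sum_nonneg fun a _ => hK _ _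

lemma PreservesPosDef.mul {X : Type*} {L L' : X → X → ℝ} (h : PreservesPosDef L)
    (h' : PreservesPosDef L') : PreservesPosDef fun p q => L p q * L' p q := fun K hK S c => by
  simpa only [mul_assoc] using h' _ (h K hK) S c

lemma PreservesPosDef.nonneg {X : Type*} {L : X → X → ℝ} (h : PreservesPosDef L) (S : Finset X)
    (c : X → ℝ) : 0 ≤ quadForm L S c := by
  have h1 := h (fun _ _ => 1) (fun S c => by
    simp only [quadForm, mul_one, ← Finset.sum_mul_sum]; exact mul_self_nonneg _) S c
  simpa using h1

lemma PreservesPosDef.one {X : Type*} : PreservesPosDef fun _ _ : X => 1 := fun K hK S c => by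
  simpa using hK S c

lemma PreservesPosDef.pow {X : Type*} {L : X → X → ℝ} (h : PreservesPosDef L) (n : ℕ) :
    PreservesPosDef fun p q => L p q ^ n := by
  induction n with
  | zero => simpa using PreservesPosDef.one
  | succ n ih => simpa only [pow_succ] using ih.mul h

variable {m : ℕ}

lemma IsZonal.preservesPosDef_comp {Y : Type*} {l : ℕ} {P : ℝ[X]} (h : IsZonal m l P)
    (g : Y → Sph m) : PreservesPosDef fun x y : Y => P.eval (dotS (g x) (g y)) := by
  obtain ⟨A, φ, hφ⟩ := h.exists_features
  simp only [hφ]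
  exact preservesPosDef_features A fun a x => φ a (g x)

lemma preservesPosDef_half_one_add_dotS :
    PreservesPosDef fun x y : Sph m => (1 + dotS x y) / 2 := by
  have h := preservesPosDef_features (X := Sph m) Finset.univ
    (fun (i : Option (Fin (m + 1))) x =>
      i.elim (Real.sqrt (1 / 2)) fun i => Real.sqrt (1 / 2) * x.1 i)
  have e : (fun x y : Sph m => (1 + dotS x y) / 2) = fun x y : Sph m =>
      ∑ i : Option (Fin (m + 1)), i.elim (Real.sqrt (1 / 2)) (fun i => Real.sqrt (1 / 2) * x.1 i) *
        i.elim (Real.sqrt (1 / 2)) fun i => Real.sqrt (1 / 2) * y.1 i := by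
    funext x y
    have hs : Real.sqrt (1 / 2) * Real.sqrt (1 / 2) = 1 / 2 := Real.mul_self_sqrt (by norm_num)
    rw [Fintype.sum_option, dotS_eq_sum, add_div, Finset.sum_div]
    simp only [Option.elim]
    rw [hs]
    congr 1
    exact Finset.sum_congr rfl fun i _ => by linear_combination (-(x.1 i * y.1 i)) * hs
  rw [e]
  exact h

/-- The integral over one variable does not depend on the other, so the double mean is the
functional itself. -/
lemma dotFunctional_nonneg {p : ℝ[X]}
    (hp : PreservesPosDef fun x y : Sph m => p.eval (dotS x y)) : 0 ≤ dotFunctional m p := by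
  have hc : Continuous fun q : Sph m × Sph m => p.eval (dotS q.1 q.2) :=
    p.continuous.comp (continuous_subtype_val.comp continuous_dotI)
  have h := integral_integral_nonneg_of_quadForm (sphMeasure m) hc hp.nonneg
  rw [integral_prod _ (integrable_of_compactSpace hc)] at h
  simpa [← dotFunctional_eq_integral] using h

/-- The product of the distributions of the inner products on `S^1` and `S^m`. -/
def dotMeasure₂ (m : ℕ) : Measure (Set.Icc (-1 : ℝ) 1 × Set.Icc (-1 : ℝ) 1) :=
  (dotMeasure 1).prod (dotMeasure m)

instance : IsProbabilityMeasure (dotMeasure₂ m) := by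
  unfold dotMeasure₂; infer_instance

lemma integral_dotMeasure₂_nonneg {F : Set.Icc (-1 : ℝ) 1 × Set.Icc (-1 : ℝ) 1 → ℝ}
    (hF : Continuous F)
    (hp : ∀ S c, 0 ≤ quadForm (fun p q : Sph 1 × Sph m => F (dotI p.1 q.1, dotI p.2 q.2)) S c) :
    0 ≤ ∫ q, F q ∂dotMeasure₂ m := by
  have hc : Continuous fun q : (Sph 1 × Sph m) × (Sph 1 × Sph m) =>
      F (dotI q.1.1 q.2.1, dotI q.1.2 q.2.2) := by
    refine hF.comp (Continuous.prodMk ?_ ?_)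
    · exact continuous_dotI.comp ((continuous_fst.comp continuous_fst).prodMk
        (continuous_fst.comp continuous_snd))
    · exact continuous_dotI.comp ((continuous_snd.comp continuous_fst).prodMk
        (continuous_snd.comp continuous_snd))
  have h := integral_integral_nonneg_of_quadForm ((sphMeasure 1).prod (sphMeasure m)) hc hp
  rw [integral_prod _ (integrable_of_compactSpace hc)] at h
  have hin (p : Sph 1 × Sph m) : ∫ q, F (dotI p.1 q.1, dotI p.2 q.2)
      ∂((sphMeasure 1).prod (sphMeasure m)) = ∫ q, F q ∂dotMeasure₂ m := by
    rw [dotMeasure₂, ← map_dotI p.1, ← map_dotI p.2,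
      Measure.map_prod_map _ _ (continuous_dotI_right _).measurable
        (continuous_dotI_right _).measurable, integral_map _ hF.aestronglyMeasurable]
    · rfl
    · exact ((continuous_dotI_right _).measurable.prodMap
        (continuous_dotI_right _).measurable).aemeasurable
  simpa [hin] using h

end Integral

/-! ### Existence of the expansion -/

section Existence

open MeasureTheory Filter Topology

variable {m : ℕ}

/-- The squared norm of `P_l^m` with respect to `dotMeasure m`. -/
def sphNormSq (m l : ℕ) : ℝ := dotFunctional m (sphPoly m l * sphPoly m l)

lemma sphNormSq_pos (hm : 1 ≤ m) (l : ℕ) : 0 < sphNormSq m l :=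
  dotFunctional_mul_self_pos hm (sphPoly_eval_one_pos hm l).ne'

lemma dotFunctional_sphPoly_mul (hm : 1 ≤ m) (k l : ℕ) :
    dotFunctional m (sphPoly m k * sphPoly m l) = if k = l then sphNormSq m l else 0 := by
  split_ifs with h
  · rw [h]; rfl
  · exact (isZonal_sphPoly hm k).dotFunctional_mul_eq_zero hm (isZonal_sphPoly hm l) h

lemma span_range_sphPoly (hm : 1 ≤ m) : Submodule.span ℝ (Set.range (sphPoly m)) = ⊤ := by
  have hne (l : ℕ) : sphPoly m l ≠ 0 := fun h => by
    have := (isZonal_sphPoly hm l).lead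
    simp [h] at this
  let S : Polynomial.Sequence ℝ := ⟨sphPoly m, fun l => by
    rw [degree_eq_natDegree (hne l), (isZonal_sphPoly hm l).natDegree_eq]⟩
  exact S.span fun l => (leadingCoeff_ne_zero.2 (hne l)).isUnit

/-- The orthogonal expansion of a polynomial. -/
lemma exists_sphPoly_expansion (hm : 1 ≤ m) (p : ℝ[X]) :
    ∃ A₀ : Finset ℕ, ∀ A, A₀ ⊆ A →
      p = ∑ l ∈ A, (dotFunctional m (p * sphPoly m l) / sphNormSq m l) • sphPoly m l := by
  have hp : p ∈ Submodule.span ℝ (Set.range (sphPoly m)) := by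
    rw [span_range_sphPoly hm]; trivial
  obtain ⟨g, hg⟩ := (Finsupp.mem_span_range_iff_exists_finsupp).1 hp
  have hcoef (l : ℕ) : dotFunctional m (p * sphPoly m l) / sphNormSq m l = g l := by
    rw [div_eq_iff (sphNormSq_pos hm l).ne', ← hg, Finsupp.sum, Finset.sum_mul, map_sum]
    simp only [smul_mul_assoc, map_smul, dotFunctional_sphPoly_mul hm, smul_eq_mul, mul_ite,
      mul_zero]
    rw [Finset.sum_ite_eq']
    split_ifs with h
    · rfl
    · rw [Finsupp.notMem_support_iff.1 h, zero_mul]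
  refine ⟨g.support, fun A hA => ?_⟩
  simp only [hcoef]
  conv_lhs => rw [← hg, Finsupp.sum]
  exact Finset.sum_subset hA fun l _ hl => by rw [Finsupp.notMem_support_iff.1 hl, zero_smul]

/-- The polynomial `(1 + X) / 2`, whose powers concentrate at `1`. -/
def peakPoly : ℝ[X] := C (1 / 2) * (1 + X)

lemma eval_peakPoly (t : ℝ) : peakPoly.eval t = (1 + t) / 2 := by
  simp [peakPoly]; ring

lemma eval_peakPoly_nonneg (t : Set.Icc (-1 : ℝ) 1) : 0 ≤ peakPoly.eval (t : ℝ) := by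
  rw [eval_peakPoly]; linarith [t.2.1]

lemma dotFunctional_peakPoly_pow_mul_nonneg (hm : 1 ≤ m) (N l : ℕ) :
    0 ≤ dotFunctional m (peakPoly ^ N * sphPoly m l) := by
  refine dotFunctional_nonneg ?_
  simp only [eval_mul, eval_pow, eval_peakPoly]
  exact (preservesPosDef_half_one_add_dotS.pow N).mul
    ((isZonal_sphPoly hm l).preservesPosDef_comp id)

lemma dotFunctional_peakPoly_pow_pos (hm : 1 ≤ m) (N : ℕ) :
    0 < dotFunctional m (peakPoly ^ N) := by
  have := isOpenPosMeasure_dotMeasure hm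
  rw [dotFunctional_apply]
  refine Continuous.integral_pos_of_hasCompactSupport_nonneg_nonzero
    (x := (⟨1, by norm_num⟩ : Set.Icc (-1 : ℝ) 1))
    ((peakPoly ^ N).continuous.comp continuous_subtype_val) (HasCompactSupport.of_compactSpace _)
    (fun t => ?_) ?_
  · simp only [eval_pow]; exact pow_nonneg (eval_peakPoly_nonneg t) N
  · norm_num [eval_peakPoly]

lemma tendsto_peakPoly (hm : 1 ≤ m) (p : ℝ[X]) :
    Tendsto (fun N => dotFunctional m (peakPoly ^ N * p) / dotFunctional m (peakPoly ^ N)) atTop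
      (𝓝 (p.eval 1)) := by
  have := isOpenPosMeasure_dotMeasure hm
  have h := tendsto_setIntegral_pow_smul_of_unique_maximum_of_isCompact_of_continuousOn
    (μ := dotMeasure m) (s := Set.univ) (x₀ := (⟨1, by norm_num⟩ : Set.Icc (-1 : ℝ) 1))
    (c := fun t => peakPoly.eval (t : ℝ)) (g := fun t => p.eval (t : ℝ)) isCompact_univ
    (peakPoly.continuous.comp continuous_subtype_val).continuousOn (fun t _ ht => by
      simp only [eval_peakPoly]
      have : (t : ℝ) ≠ 1 := fun h => ht (Subtype.ext h)
      have := lt_of_le_of_ne t.2.2 this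
      linarith) (fun t _ => eval_peakPoly_nonneg t) (by norm_num [eval_peakPoly]) (by simp)
    (p.continuous.comp continuous_subtype_val).continuousOn
  simp only [Measure.restrict_univ, smul_eq_mul] at h
  refine h.congr fun N => ?_
  rw [dotFunctional_apply, dotFunctional_apply, div_eq_inv_mul]
  simp only [eval_mul, eval_pow]

variable {F : Set.Icc (-1 : ℝ) 1 × Set.Icc (-1 : ℝ) 1 → ℝ}

/-- The moments of a function on `[-1, 1]²` with respect to products of polynomials. -/
def mixedMoment (m : ℕ) (F : Set.Icc (-1 : ℝ) 1 × Set.Icc (-1 : ℝ) 1 → ℝ) (p q : ℝ[X]) : ℝ :=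
  ∫ x, F x * (p.eval (x.1 : ℝ) * q.eval (x.2 : ℝ)) ∂dotMeasure₂ m

lemma continuous_mixed (p q : ℝ[X]) :
    Continuous fun x : Set.Icc (-1 : ℝ) 1 × Set.Icc (-1 : ℝ) 1 =>
      p.eval (x.1 : ℝ) * q.eval (x.2 : ℝ) :=
  (p.continuous.comp (continuous_subtype_val.comp continuous_fst)).mul
    (q.continuous.comp (continuous_subtype_val.comp continuous_snd))

lemma mixedMoment_sum (hF : Continuous F) (A : Finset ℕ) (c d : ℕ → ℝ) (P Q : ℕ → ℝ[X]) :
    mixedMoment m F (∑ k ∈ A, c k • P k) (∑ l ∈ A, d l • Q l) =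
      ∑ k ∈ A, ∑ l ∈ A, c k * d l * mixedMoment m F (P k) (Q l) := by
  have hInt (k l : ℕ) : Integrable (fun x : Set.Icc (-1 : ℝ) 1 × Set.Icc (-1 : ℝ) 1 =>
      c k * d l * (F x * ((P k).eval (x.1 : ℝ) * (Q l).eval (x.2 : ℝ)))) (dotMeasure₂ m) :=
    (integrable_of_compactSpace (hF.mul (continuous_mixed _ _))).const_mul _
  simp only [mixedMoment, ← integral_const_mul]
  rw [Finset.sum_congr rfl fun k _ => (integral_finsetSum A fun l _ => hInt k l).symm,
    ← integral_finsetSum A fun k _ => integrable_finsetSum A fun l _ => hInt k l]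
  refine integral_congr_ae (Eventually.of_forall fun x => ?_)
  simp only [eval_finsetSum, eval_smul, smul_eq_mul, Finset.sum_mul_sum]
  simp only [Finset.mul_sum]
  exact Finset.sum_congr rfl fun k _ => Finset.sum_congr rfl fun l _ => by ring

lemma integral_mixed (p q : ℝ[X]) :
    ∫ x, p.eval (x.1 : ℝ) * q.eval (x.2 : ℝ) ∂dotMeasure₂ m =
      dotFunctional 1 p * dotFunctional m q := by
  rw [dotFunctional_apply, dotFunctional_apply, dotMeasure₂]
  exact integral_prod_mul (fun t : Set.Icc (-1 : ℝ) 1 => p.eval (t : ℝ))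
    fun t : Set.Icc (-1 : ℝ) 1 => q.eval (t : ℝ)

/-- The expansion coefficients of a function on `[-1, 1]²`. -/
def expCoeff (m : ℕ) (F : Set.Icc (-1 : ℝ) 1 × Set.Icc (-1 : ℝ) 1 → ℝ) (k l : ℕ) : ℝ :=
  mixedMoment m F (sphPoly 1 k) (sphPoly m l) / (sphNormSq 1 k * sphNormSq m l)

lemma expCoeff_mul (hm : 1 ≤ m) (k l : ℕ) :
    expCoeff m F k l * (sphNormSq 1 k * sphNormSq m l) =
      mixedMoment m F (sphPoly 1 k) (sphPoly m l) :=
  div_mul_cancel₀ _ (mul_pos (sphNormSq_pos le_rfl k) (sphNormSq_pos hm l)).ne'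

lemma expCoeff_nonneg (hm : 1 ≤ m) (hF : Continuous F)
    (hp : ∀ S c, 0 ≤ quadForm (fun p q : Sph 1 × Sph m => F (dotI p.1 q.1, dotI p.2 q.2)) S c)
    (k l : ℕ) : 0 ≤ expCoeff m F k l := by
  refine div_nonneg ?_ (mul_pos (sphNormSq_pos le_rfl k) (sphNormSq_pos hm l)).le
  exact integral_dotMeasure₂_nonneg (hF.mul (continuous_mixed _ _)) fun S c =>
    (((isZonal_sphPoly le_rfl k).preservesPosDef_comp (Prod.fst : Sph 1 × Sph m → Sph 1)).mul
      ((isZonal_sphPoly hm l).preservesPosDef_comp Prod.snd)) _ hp S c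

/-- Integrate `F` against `peakPoly ^ N` in both variables. The result is at most `M` times the
total mass, and it is a finite sum of nonnegative terms, so any partial sum obeys the bound. As N
grows the normalized moments tend to the values at 1. -/
lemma sum_expCoeff_le (hm : 1 ≤ m) (hF : Continuous F) {M : ℝ} (hM : ∀ x, F x ≤ M)
    (ha : ∀ k l, 0 ≤ expCoeff m F k l) (u : Finset (ℕ × ℕ)) :
    ∑ i ∈ u, expCoeff m F i.1 i.2 * (sphPoly 1 i.1).eval 1 * (sphPoly m i.2).eval 1 ≤ M := by
  have hlim : Tendsto (fun N => ∑ i ∈ u, expCoeff m F i.1 i.2 *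
      (dotFunctional 1 (peakPoly ^ N * sphPoly 1 i.1) / dotFunctional 1 (peakPoly ^ N)) *
      (dotFunctional m (peakPoly ^ N * sphPoly m i.2) / dotFunctional m (peakPoly ^ N))) atTop
      (𝓝 (∑ i ∈ u, expCoeff m F i.1 i.2 * (sphPoly 1 i.1).eval 1 * (sphPoly m i.2).eval 1)) :=
    tendsto_finsetSum _ fun i _ =>
      ((tendsto_peakPoly le_rfl _).const_mul _).mul (tendsto_peakPoly hm _)
  refine le_of_tendsto' hlim fun N => ?_
  set p := peakPoly ^ N with hp
  have hp1 := dotFunctional_peakPoly_pow_pos (m := 1) le_rfl N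
  have hpm := dotFunctional_peakPoly_pow_pos hm N
  obtain ⟨A₁, hA₁⟩ := exists_sphPoly_expansion (m := 1) le_rfl p
  obtain ⟨A₂, hA₂⟩ := exists_sphPoly_expansion hm p
  set A := (A₁ ∪ A₂) ∪ (u.image Prod.fst ∪ u.image Prod.snd) with hA
  have e1 := hA₁ A (Finset.subset_union_left.trans Finset.subset_union_left)
  have e2 := hA₂ A (Finset.subset_union_right.trans Finset.subset_union_left)
  have hu : u ⊆ A ×ˢ A := fun i hi => by
    simp only [Finset.mem_product, hA, Finset.mem_union, Finset.mem_image]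
    exact ⟨Or.inr (Or.inl ⟨i, hi, rfl⟩), Or.inr (Or.inr ⟨i, hi, rfl⟩)⟩
  have hT : mixedMoment m F p p = ∑ i ∈ A ×ˢ A, expCoeff m F i.1 i.2 *
      dotFunctional 1 (p * sphPoly 1 i.1) * dotFunctional m (p * sphPoly m i.2) := by
    have h0 : mixedMoment m F p p = mixedMoment m F
        (∑ l ∈ A, (dotFunctional 1 (p * sphPoly 1 l) / sphNormSq 1 l) • sphPoly 1 l)
        (∑ l ∈ A, (dotFunctional m (p * sphPoly m l) / sphNormSq m l) • sphPoly m l) := by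
      rw [← e1, ← e2]
    rw [h0, mixedMoment_sum hF, Finset.sum_product]
    refine Finset.sum_congr rfl fun k _ => Finset.sum_congr rfl fun l _ => ?_
    rw [← expCoeff_mul hm]
    have := (sphNormSq_pos (m := 1) le_rfl k).ne'
    have := (sphNormSq_pos hm l).ne'
    field_simp
  have hTM : mixedMoment m F p p ≤ M * (dotFunctional 1 p * dotFunctional m p) := by
    rw [← integral_mixed, ← integral_const_mul]
    refine integral_mono (integrable_of_compactSpace (hF.mul (continuous_mixed _ _)))
      ((integrable_of_compactSpace (continuous_mixed _ _)).const_mul _) fun x => ?_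
    refine mul_le_mul_of_nonneg_right (hM x) (mul_nonneg ?_ ?_) <;>
    · rw [hp, eval_pow]
      exact pow_nonneg (eval_peakPoly_nonneg _) _
  have hle : ∑ i ∈ u, expCoeff m F i.1 i.2 * dotFunctional 1 (p * sphPoly 1 i.1) *
      dotFunctional m (p * sphPoly m i.2) ≤ M * (dotFunctional 1 p * dotFunctional m p) := by
    refine le_trans ?_ (hT ▸ hTM)
    exact Finset.sum_le_sum_of_subset_of_nonneg hu fun i _ _ => mul_nonneg (mul_nonneg (ha _ _)
      (dotFunctional_peakPoly_pow_mul_nonneg le_rfl _ _))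
      (dotFunctional_peakPoly_pow_mul_nonneg hm _ _)
  rw [← hp] at hp1 hpm
  rw [← div_le_iff₀ (mul_pos hp1 hpm), Finset.sum_div] at hle
  refine le_trans (le_of_eq (Finset.sum_congr rfl fun i _ => ?_)) hle
  ring

lemma eq_zero_of_forall_integral_mul_polynomial (hm : 1 ≤ m) {H : Set.Icc (-1 : ℝ) 1 → ℝ}
    (hH : Continuous H) (h0 : ∀ p : ℝ[X], ∫ t, H t * p.eval (t : ℝ) ∂dotMeasure m = 0) : H = 0 := by
  have := isOpenPosMeasure_dotMeasure hm
  by_contra hne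
  obtain ⟨t₀, ht₀⟩ := Function.ne_iff.1 hne
  have hpos : 0 < ∫ t, H t * H t ∂dotMeasure m :=
    Continuous.integral_pos_of_hasCompactSupport_nonneg_nonzero (x := t₀) (hH.mul hH)
      (HasCompactSupport.of_compactSpace _) (fun t => mul_self_nonneg _)
      (mul_ne_zero ht₀ ht₀)
  set A := ∫ t, H t * H t ∂dotMeasure m
  set B := ∫ t, |H t| ∂dotMeasure m
  have hB : 0 ≤ B := integral_nonneg fun t => abs_nonneg _
  have hle : (-1 : ℝ) ≤ 1 := by norm_num
  -- With this tolerance, orthogonality to `p` gives A ≤ A B / (B + 1), which is impossible for A >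
  -- 0.
  obtain ⟨p, hp⟩ := exists_polynomial_near_of_continuousOn (-1) 1 (Set.IccExtend hle H)
    (hH.Icc_extend').continuousOn (A / (B + 1)) (by positivity)
  have hpt (t : Set.Icc (-1 : ℝ) 1) : |H t - p.eval (t : ℝ)| ≤ A / (B + 1) := by
    rw [abs_sub_comm]
    have h1 := (hp t t.2).le
    rwa [Set.IccExtend_of_mem hle H t.2] at h1
  have hpc : Continuous fun t : Set.Icc (-1 : ℝ) 1 => p.eval (t : ℝ) :=
    p.continuous.comp continuous_subtype_val
  have hA : A ≤ A / (B + 1) * B := by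
    calc A = ∫ t, H t * H t ∂dotMeasure m - ∫ t, H t * p.eval (t : ℝ) ∂dotMeasure m := by
          rw [h0, sub_zero]
      _ = ∫ t, (H t * H t - H t * p.eval (t : ℝ)) ∂dotMeasure m :=
          (integral_sub (integrable_of_compactSpace (hH.mul hH))
            (integrable_of_compactSpace (hH.mul hpc))).symm
      _ ≤ ∫ t, A / (B + 1) * |H t| ∂dotMeasure m := by
          refine integral_mono (integrable_of_compactSpace ((hH.mul hH).sub (hH.mul hpc)))
            ((integrable_of_compactSpace hH.abs).const_mul _) fun t => ?_
          rw [← mul_sub]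
          refine (le_abs_self _).trans ?_
          rw [abs_mul, mul_comm]
          exact mul_le_mul_of_nonneg_right (hpt t) (abs_nonneg _)
      _ = _ := integral_const_mul _ _
  rw [div_mul_eq_mul_div, le_div_iff₀ (by positivity)] at hA
  linarith

/-- The one-variable statement is used twice: first for the partial integrals over s as functions of
t, then for `D` at fixed t. -/
lemma eq_zero_of_forall_mixedMoment (hm : 1 ≤ m) {D : Set.Icc (-1 : ℝ) 1 × Set.Icc (-1 : ℝ) 1 → ℝ}
    (hD : Continuous D) (h0 : ∀ k l, mixedMoment m D (sphPoly 1 k) (sphPoly m l) = 0) : D = 0 := by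
  have h1 (p q : ℝ[X]) : mixedMoment m D p q = 0 := by
    obtain ⟨A₁, hA₁⟩ := exists_sphPoly_expansion (m := 1) le_rfl p
    obtain ⟨A₂, hA₂⟩ := exists_sphPoly_expansion hm q
    rw [hA₁ (A₁ ∪ A₂) Finset.subset_union_left, hA₂ (A₁ ∪ A₂) Finset.subset_union_right,
      mixedMoment_sum hD]
    simp [h0]
  have h2 (q : ℝ[X]) : (fun t => ∫ s, D (t, s) * q.eval (s : ℝ) ∂dotMeasure m) = 0 := by
    refine eq_zero_of_forall_integral_mul_polynomial (m := 1) le_rfl ?_ fun p => ?_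
    · have hc : Continuous (Function.uncurry fun t s : Set.Icc (-1 : ℝ) 1 =>
          D (t, s) * q.eval (s : ℝ)) :=
        hD.mul (q.continuous.comp (continuous_subtype_val.comp continuous_snd))
      simpa using continuous_parametric_integral_of_continuous (μ := dotMeasure m) hc isCompact_univ
    · rw [← h1 p q, mixedMoment, dotMeasure₂,
        integral_prod (fun x : Set.Icc (-1 : ℝ) 1 × Set.Icc (-1 : ℝ) 1 =>
          D x * (p.eval (x.1 : ℝ) * q.eval (x.2 : ℝ)))
          (integrable_of_compactSpace (hD.mul (continuous_mixed p q)))]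
      refine integral_congr_ae (Eventually.of_forall fun t => ?_)
      simp only [← integral_mul_const]
      exact integral_congr_ae (Eventually.of_forall fun s => by ring)
  funext x
  have h3 := eq_zero_of_forall_integral_mul_polynomial hm (H := fun s => D (x.1, s))
    (hD.comp (Continuous.prodMk_right x.1)) fun q => congrFun (h2 q) x.1
  exact congrFun h3 x.2

/-- The general term of a double series in `P_k^1(t) P_l^m(s)`. -/
def seriesTerm (m : ℕ) (a : ℕ → ℕ → ℝ) (i : ℕ × ℕ)
    (x : Set.Icc (-1 : ℝ) 1 × Set.Icc (-1 : ℝ) 1) : ℝ :=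
  a i.1 i.2 * (sphPoly 1 i.1).eval (x.1 : ℝ) * (sphPoly m i.2).eval (x.2 : ℝ)

lemma continuous_seriesTerm (a : ℕ → ℕ → ℝ) (i : ℕ × ℕ) : Continuous (seriesTerm m a i) := by
  refine ((continuous_mixed (sphPoly 1 i.1) (sphPoly m i.2)).const_mul (a i.1 i.2)).congr
    fun x => ?_
  rw [seriesTerm, mul_assoc]

lemma norm_mixed_sphPoly_le (hm : 1 ≤ m) (k l : ℕ)
    (x : Set.Icc (-1 : ℝ) 1 × Set.Icc (-1 : ℝ) 1) :
    ‖(sphPoly 1 k).eval (x.1 : ℝ) * (sphPoly m l).eval (x.2 : ℝ)‖ ≤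
      (sphPoly 1 k).eval 1 * (sphPoly m l).eval 1 := by
  simp only [norm_mul, Real.norm_eq_abs]
  exact mul_le_mul ((isZonal_sphPoly le_rfl _).abs_eval_le le_rfl x.1.2)
    ((isZonal_sphPoly hm _).abs_eval_le hm x.2.2) (abs_nonneg _)
    (sphPoly_eval_one_pos le_rfl _).le

variable {a : ℕ → ℕ → ℝ}

lemma norm_seriesTerm_le (hm : 1 ≤ m) (ha : ∀ k l, 0 ≤ a k l) (i : ℕ × ℕ)
    (x : Set.Icc (-1 : ℝ) 1 × Set.Icc (-1 : ℝ) 1) :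
    ‖seriesTerm m a i x‖ ≤ a i.1 i.2 * (sphPoly 1 i.1).eval 1 * (sphPoly m i.2).eval 1 := by
  rw [seriesTerm, mul_assoc, mul_assoc, norm_mul, Real.norm_of_nonneg (ha _ _)]
  exact mul_le_mul_of_nonneg_left (norm_mixed_sphPoly_le hm _ _ x) (ha _ _)

lemma integral_seriesTerm_mul (hm : 1 ≤ m) (i : ℕ × ℕ) (k l : ℕ) :
    ∫ x, seriesTerm m a i x * ((sphPoly 1 k).eval (x.1 : ℝ) * (sphPoly m l).eval (x.2 : ℝ))
      ∂dotMeasure₂ m = if i = (k, l) then a k l * (sphNormSq 1 k * sphNormSq m l) else 0 := by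
  have e (x : Set.Icc (-1 : ℝ) 1 × Set.Icc (-1 : ℝ) 1) : seriesTerm m a i x *
      ((sphPoly 1 k).eval (x.1 : ℝ) * (sphPoly m l).eval (x.2 : ℝ)) =
      a i.1 i.2 * ((sphPoly 1 i.1 * sphPoly 1 k).eval (x.1 : ℝ) *
        (sphPoly m i.2 * sphPoly m l).eval (x.2 : ℝ)) := by
    simp only [seriesTerm, eval_mul]; ring
  simp only [e]
  rw [integral_const_mul, integral_mixed, dotFunctional_sphPoly_mul le_rfl,
    dotFunctional_sphPoly_mul hm]
  by_cases h : i = (k, l)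
  · subst h; simp
  · rw [if_neg h]
    by_cases h1 : i.1 = k
    · rw [if_neg fun h2 : i.2 = l => h (Prod.ext h1 h2), mul_zero, mul_zero]
    · rw [if_neg h1, zero_mul, mul_zero]

lemma mixedMoment_tsum_seriesTerm (hm : 1 ≤ m) (ha : ∀ k l, 0 ≤ a k l)
    (hsum : Summable fun i : ℕ × ℕ =>
      a i.1 i.2 * (sphPoly 1 i.1).eval 1 * (sphPoly m i.2).eval 1) (k l : ℕ) :
    mixedMoment m (fun x => ∑' i, seriesTerm m a i x) (sphPoly 1 k) (sphPoly m l) =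
      a k l * (sphNormSq 1 k * sphNormSq m l) := by
  set r : Set.Icc (-1 : ℝ) 1 × Set.Icc (-1 : ℝ) 1 → ℝ := fun x =>
    (sphPoly 1 k).eval (x.1 : ℝ) * (sphPoly m l).eval (x.2 : ℝ) with hr
  have hInt (i : ℕ × ℕ) : Integrable (fun x => seriesTerm m a i x * r x) (dotMeasure₂ m) :=
    integrable_of_compactSpace ((continuous_seriesTerm a i).mul (continuous_mixed _ _))
  have hbound (i : ℕ × ℕ) (x) : ‖seriesTerm m a i x * r x‖ ≤
      a i.1 i.2 * (sphPoly 1 i.1).eval 1 * (sphPoly m i.2).eval 1 *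
        ((sphPoly 1 k).eval 1 * (sphPoly m l).eval 1) := by
    rw [norm_mul]
    exact mul_le_mul (norm_seriesTerm_le hm ha i x) (norm_mixed_sphPoly_le hm k l x)
      (norm_nonneg _) ((norm_nonneg _).trans (norm_seriesTerm_le hm ha i x))
  have hnorm (i : ℕ × ℕ) : ∫ x, ‖seriesTerm m a i x * r x‖ ∂dotMeasure₂ m ≤
      a i.1 i.2 * (sphPoly 1 i.1).eval 1 * (sphPoly m i.2).eval 1 *
        ((sphPoly 1 k).eval 1 * (sphPoly m l).eval 1) :=
    (integral_mono (hInt i).norm (integrable_const _) (hbound i)).trans (le_of_eq (by simp))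
  have h1 := hasSum_integral_of_summable_integral_norm (μ := dotMeasure₂ m) hInt
    ((hsum.mul_right ((sphPoly 1 k).eval 1 * (sphPoly m l).eval 1)).of_nonneg_of_le
      (fun i => integral_nonneg fun x => norm_nonneg _) hnorm)
  simp only [hr, integral_seriesTerm_mul hm] at h1
  rw [mixedMoment, ← h1.unique (hasSum_ite_eq (k, l) _)]
  exact integral_congr_ae (Eventually.of_forall fun x => tsum_mul_right.symm)

theorem exists_isExpansion (hm : 2 ≤ m) {f : ℝ → ℝ → ℝ} (hf : GeneratesPosDef m f) :
    ∃ a : ℕ → ℕ → ℝ, IsExpansion m f a := by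
  have hm1 : 1 ≤ m := by omega
  obtain ⟨F, hFf⟩ : ∃ F : Set.Icc (-1 : ℝ) 1 × Set.Icc (-1 : ℝ) 1 → ℝ,
    ∀ x, F x = f x.1 x.2 := ⟨fun x => f x.1 x.2, fun _ => rfl⟩
  have hF : Continuous F := by
    have h := hf.1
    rw [continuousOn_iff_continuous_domRestrict] at h
    have h2 := h.comp (f := fun x : Set.Icc (-1 : ℝ) 1 × Set.Icc (-1 : ℝ) 1 =>
      (⟨((x.1 : ℝ), (x.2 : ℝ)), x.1.2, x.2.2⟩ :
        ((Set.Icc (-1 : ℝ) 1 ×ˢ Set.Icc (-1 : ℝ) 1 : Set (ℝ × ℝ)))))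
      (by fun_prop)
    exact h2.congr fun x => (hFf x).symm
  obtain ⟨a, haF⟩ : ∃ a, a = expCoeff m F := ⟨_, rfl⟩
  have hpd : ∀ S c, 0 ≤ quadForm
      (fun p q : Sph 1 × Sph m => F (dotI p.1 q.1, dotI p.2 q.2)) S c := fun S c => by
    simp only [hFf]
    exact hf.2.quadForm_nonneg S c
  have ha : ∀ k l, 0 ≤ a k l := haF ▸ expCoeff_nonneg hm1 hF hpd
  obtain ⟨M, hM⟩ := (isCompact_range hF).bddAbove
  have hsum : Summable fun i : ℕ × ℕ =>
      a i.1 i.2 * (sphPoly 1 i.1).eval 1 * (sphPoly m i.2).eval 1 := by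
    refine summable_of_sum_le (fun i => mul_nonneg (mul_nonneg (ha _ _)
      (sphPoly_eval_one_pos le_rfl _).le) (sphPoly_eval_one_pos hm1 _).le) (c := M) ?_
    subst haF
    exact sum_expCoeff_le hm1 hF (fun x => hM ⟨x, rfl⟩) ha
  have hGc : Continuous fun x => ∑' i, seriesTerm m a i x :=
    continuous_tsum (continuous_seriesTerm a) hsum (norm_seriesTerm_le hm1 ha)
  -- The series is continuous and, by orthogonality, has the same mixed moments as `F`.
  have hFG : F - (fun x => ∑' i, seriesTerm m a i x) = 0 := by
    refine eq_zero_of_forall_mixedMoment hm1 (hF.sub hGc) fun k l => ?_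
    have hInt {H : Set.Icc (-1 : ℝ) 1 × Set.Icc (-1 : ℝ) 1 → ℝ} (hH : Continuous H) :
        Integrable (fun x => H x * ((sphPoly 1 k).eval (x.1 : ℝ) * (sphPoly m l).eval (x.2 : ℝ)))
          (dotMeasure₂ m) :=
      integrable_of_compactSpace (hH.mul (continuous_mixed _ _))
    have hG := mixedMoment_tsum_seriesTerm hm1 ha hsum k l
    rw [haF, expCoeff_mul hm1, ← haF] at hG
    unfold mixedMoment at hG ⊢
    simp only [Pi.sub_apply, sub_mul]
    rw [integral_sub (hInt hF) (hInt hGc), hG, sub_self]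
  refine ⟨a, ha, hsum, fun t ht s hs => ?_⟩
  have hs1 : Summable fun i => seriesTerm m a i (⟨t, ht⟩, ⟨s, hs⟩) :=
    hsum.of_norm_bounded fun i => norm_seriesTerm_le hm1 ha i _
  have h2 := hs1.hasSum
  have h3 := congrFun (sub_eq_zero.1 hFG) (⟨t, ht⟩, ⟨s, hs⟩)
  rw [hFf] at h3
  rw [← h3] at h2
  exact h2

end Existence

end SpherePD

end

theorem theorem3p10 (m : ℕ) (hm : 2 ≤ m) (f : ℝ → ℝ → ℝ)
    (hf : SpherePD.GeneratesPosDef m f) :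
    (∃ a : ℕ → ℕ → ℝ, SpherePD.IsExpansion m f a) ∧
      ∀ a : ℕ → ℕ → ℝ, SpherePD.IsExpansion m f a →
        (SpherePD.IsStrictPosDefKernel (SpherePD.prodKernel m f) ↔
          ∀ γ : ℕ, SpherePD.GeneratesStrictPosDefCircle (SpherePD.oddTail a γ) ∧
            SpherePD.GeneratesStrictPosDefCircle (SpherePD.evenTail a γ)) := by
  exact ⟨SpherePD.exists_isExpansion hm hf, fun _ ha => ha.isStrictPosDefKernel_iff hm hf.2⟩
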